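/- Let $m\ge 3$ be an integer, and let $M\subset\mathbb C^2$ be a connected open neighbourhood of $0$ with coordinates $t=(t_1,t_2)$, $\partial_i=\partial/\partial t_i$, viewed as a representative of the germ at $0$ of the F-manifold $I_2(m)$: the unit field is $e=\partial_1$, $\partial_2\circ\partial_2=t_2^{m-2}\partial_1$, and the Euler field is $E=t_1\partial_1+\frac2m t_2\partial_2$. Its analytic spectrum is $L_M=\{(t,y)\in M\times\mathbb C^2 : y_1=1,\ y_2^2=t_2^{m-2}\}\subset T^*M$, and its bifurcation set $\mathcal K^{bif}$ is the set of points of $M$ at which the eigenvalues of $E\circ$ are not all different. A $(TE)$-structure of rank $2$ on $M$ is a holomorphic vector bundle $H\to\mathbb C\times M$ of rank $2$ (the coordinate on $\mathbb C$ is $z$) with a flat connection $\nabla$ on $H|_{\mathbb C^*\times M}$ which maps $\mathcal O(H)$ to $\bigl(\frac1z\mathcal O_{\mathbb C\times M}\,\Omega^1_M+\frac1{z^2}\mathcal O_{\mathbb C\times M}\,dz\bigr)\otimes\mathcal O(H)$. On $K=H|_{\{0\}\times M}$ let $C_X=[z\nabla_X]$ and $\mathcal U=[z^2\nabla_{\partial_z}]$.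 The $(TE)$-structure is over $I_2(m)$ if a section $\zeta$ of $K$ exists such that $X\mapsto C_X\zeta$ is an isomorphism $TM\to K$, and if $C_XC_Y=C_{X\circ Y}$, $C_e=\mathrm{id}$ and $C_E=-\mathcal U$. For $t^0\in M\setminus\mathcal K^{bif}$, the regular singular exponents over $t^0$ are the numbers $\alpha_1,\alpha_2$ in a formal (in $z$) decomposition of the restriction of $(H,\nabla)$ to $t^0$ into rank $1$ pieces $\nabla=d+(-u_iz^{-2}+\alpha_iz^{-1})\,dz$. The exponent at the point $(t^0,y)\in L_M$ is the $\alpha_i$ for which $u_i$ is the value $y(E)$ at $t^0$. Consider a $(TE)$-structure over $I_2(m)$, and suppose that on $V\times M$, for some open neighbourhood $V$ of $0$ in $\mathbb C$, $H$ has a holomorphic basis $\underline v=(v_1,v_2)$ with $\nabla\underline v=\underline v\,(z^{-1}A_1dt_1+z^{-1}A_2dt_2+z^{-2}B\,dz)$ in the normal form $$A_1=\mathbf 1_2,\qquad A_2=C_2+zf\,\mathcal E,\qquad B=\Bigl(-t_1\mathbf 1_2-\tfrac2mt_2C_2\Bigr)+z\Bigl(\alpha\mathbf 1_2+\tfrac{2-m}{2m}\mathcal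 D-\tfrac2mt_2f\,\mathcal E\Bigr),$$ $$C_2=\begin{pmatrix}0&t_2^{m-2}\\1&0\end{pmatrix},\quad \mathcal D=\begin{pmatrix}1&0\\0&-1\end{pmatrix},\quad \mathcal E=\begin{pmatrix}0&1\\0&0\end{pmatrix},\quad f=\begin{cases}0&(m\text{ odd})\\ \lambda\,t_2^{(m-4)/2}&(m\text{ even})\end{cases}$$ with $\alpha,\lambda\in\mathbb C$. (i) If $m$ is even, then $L_M$ has exactly two irreducible components. The regular singular exponents over every $t^0\in M\setminus\mathcal K^{bif}$ are $\alpha-\frac{\lambda}{m}$ and $\alpha+\frac{\lambda}{m}$ (counted with multiplicity): the exponent is constantly $\alpha-\frac\lambda m$ on one component of $L_M$ and constantly $\alpha+\frac\lambda m$ on the other (at points over $M\setminus\mathcal K^{bif}$). (ii) If $m$ is odd, then $L_M$ has exactly one irreducible component, and $\alpha$ is the only regular singular exponent: over every $t^0\in M\setminus\mathcal K^{bif}$ both exponents equal $\alpha$. -/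

import Mathlib

open scoped Manifold ContDiff Bundle

noncomputable section

namespace TE

/-! ### Analytic sets and their irreducible components -/

section AnalyticSets

variable {V : Type*} [NormedAddCommGroup V] [NormedSpace ℂ V]

/-- `Z` is a (closed) analytic subset of the open set `Ω`: near every point of `Ω` it is the common
zero set of finitely many holomorphic functions. -/
def IsAnalyticSubset (Ω Z : Set V) : Prop :=
  Z ⊆ Ω ∧ ∀ p ∈ Ω, ∃ W : Set V, IsOpen W ∧ p ∈ W ∧ W ⊆ Ω ∧
    ∃ (k : ℕ) (g : Fin k → V → ℂ), (∀ i, AnalyticOnNhd ℂ (g i) W) ∧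
      Z ∩ W = {x ∈ W | ∀ i, g i x = 0}

/-- A nonempty analytic subset of `Ω` which is not the union of two smaller analytic subsets. -/
def IsIrreducibleAnalyticSubset (Ω Z : Set V) : Prop :=
  IsAnalyticSubset Ω Z ∧ Z.Nonempty ∧
    ∀ Z₁ Z₂ : Set V, IsAnalyticSubset Ω Z₁ → IsAnalyticSubset Ω Z₂ →
      Z = Z₁ ∪ Z₂ → Z = Z₁ ∨ Z = Z₂

/-- The irreducible components of a subset `X` of `Ω` (as a reduced complex space): the maximal
irreducible analytic subsets of `Ω` contained in `X`. -/
def components (Ω X : Set V) : Set (Set V) :=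
  {Z | Maximal (fun Y => IsIrreducibleAnalyticSubset Ω Y ∧ Y ⊆ X) Z}

end AnalyticSets

/-! ### Multiplications on the tangent bundle, unit field, Euler field -/

/-- A multiplication on the tangent bundle of (an open subset of) `ℂⁿ` with unit field and
Euler field, in coordinates: `∂ᵢ ∘ ∂ⱼ = ∑ₖ mul t i j k ∂ₖ`, `e = ∑ₖ unit t k ∂ₖ`,
`E = ∑ₖ euler t k ∂ₖ`. -/
structure TangentData (n : ℕ) where
  mul : (Fin n → ℂ) → Fin n → Fin n → Fin n → ℂ
  unit : (Fin n → ℂ) → Fin n → ℂ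
  euler : (Fin n → ℂ) → Fin n → ℂ

/-- The F-manifold `I₂(m)`: `e = ∂₁`, `∂₂ ∘ ∂₂ = t₂^(m-2) ∂₁`, with the Euler field
`E = t₁ ∂₁ + (2/m) t₂ ∂₂`. The coordinates `t₁, t₂` are `t 0, t 1`. -/
def I2 (m : ℕ) : TangentData 2 where
  mul t := ![![![1, 0], ![0, 1]], ![![0, 1], ![t 1 ^ (m - 2), 0]]]
  unit _ := ![1, 0]
  euler t := ![t 0, 2 / (m : ℂ) * t 1]

namespace TangentData

variable {n : ℕ} (F : TangentData n)

/-- The analytic spectrum `L_M ⊆ T^*M = M × ℂⁿ` (as a set), `y` being the fibre coordinates. -/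
def spectrum (M : TopologicalSpace.Opens (Fin n → ℂ)) : Set ((Fin n → ℂ) × (Fin n → ℂ)) :=
  {p | p.1 ∈ M ∧ ∑ k, F.unit p.1 k * p.2 k = 1 ∧
    ∀ i j, p.2 i * p.2 j = ∑ k, F.mul p.1 i j k * p.2 k}

/-- The irreducible components of the analytic spectrum `L_M`. -/
def spectrumComponents (M : TopologicalSpace.Opens (Fin n → ℂ)) :
    Set (Set ((Fin n → ℂ) × (Fin n → ℂ))) :=
  components ((M : Set (Fin n → ℂ)) ×ˢ Set.univ) (F.spectrum M)

/-- The matrix of `E ∘ : T_t M → T_t M` in the basis `∂₁, …, ∂ₙ`. -/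
def eulerMatrix (t : Fin n → ℂ) : Matrix (Fin n) (Fin n) ℂ :=
  Matrix.of fun k j => ∑ i, F.euler t i * F.mul t i j k

/-- The bifurcation set: the points at which the eigenvalues of `E ∘` are not all different. -/
def bifurcationSet (M : TopologicalSpace.Opens (Fin n → ℂ)) : Set (Fin n → ℂ) :=
  {t | t ∈ M ∧ ¬ (F.eulerMatrix t).charpoly.roots.Nodup}

end TangentData

/-! ### (TE)-structures -/

/-- The open subset `ℂ × M` of `ℂ × ℂⁿ`; its points are pairs `(z, t)`. -/
def prodC {n : ℕ} (M : TopologicalSpace.Opens (Fin n → ℂ)) :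
    TopologicalSpace.Opens (ℂ × (Fin n → ℂ)) :=
  ⟨Prod.snd ⁻¹' (M : Set (Fin n → ℂ)), M.isOpen.preimage continuous_snd⟩

/-- The complex manifold `ℂ × M`. -/
abbrev Base {n : ℕ} (M : TopologicalSpace.Opens (Fin n → ℂ)) : Type := prodC M

/-- The point `(z, t)` of `ℂ × M`. -/
def pt {n : ℕ} {M : TopologicalSpace.Opens (Fin n → ℂ)} (z : ℂ) (t : M) : Base M :=
  ⟨(z, (t : Fin n → ℂ)), t.2⟩

section Bundle

variable {n r : ℕ} {M : TopologicalSpace.Opens (Fin n → ℂ)} {H : Base M → Type*}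
  [TopologicalSpace (Bundle.TotalSpace (Fin r → ℂ) H)]
  [∀ x, AddCommGroup (H x)] [∀ x, Module ℂ (H x)] [∀ x, TopologicalSpace (H x)]
  [FiberBundle (Fin r → ℂ) H]

variable (r) in
/-- The section `s` of the rank `r` bundle `H → ℂ × M` is holomorphic on the set `W`. -/
def HolSection (s : ∀ x, H x) (W : Set (Base M)) : Prop :=
  ContMDiffOn 𝓘(ℂ, ℂ × (Fin n → ℂ)) (𝓘(ℂ, ℂ × (Fin n → ℂ)).prod 𝓘(ℂ, Fin r → ℂ)) ω
    (fun x => Bundle.TotalSpace.mk' (Fin r → ℂ) x (s x)) W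

variable (r) in
/-- `v` is a holomorphic basis of the rank `r` bundle `H` on the set `W`. -/
def HolBasis (v : Fin r → ∀ x, H x) (W : Set (Base M)) : Prop :=
  IsLocalFrameOn 𝓘(ℂ, ℂ × (Fin n → ℂ)) (Fin r → ℂ) ω v W

variable (r H) in
/-- A (TE)-structure on the rank `r` holomorphic vector bundle `H → ℂ × M`, i.e. a flat connection
`∇` on `H|_{ℂ^* × M}` with a pole of Poincaré rank 1 along `{0} × M`:
`∇ : 𝓞(H) → (z⁻¹ 𝓞 Ω¹_M + z⁻² 𝓞 dz) ⊗ 𝓞(H)`. It is given by the operators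
`D i = z ∇_{∂ᵢ}` and `Dz = z² ∇_{∂_z}`, which act on the holomorphic sections over open subsets of
`ℂ × M`. (A section over an open set `W` is represented by a function on `ℂ × M` whose values
outside `W` are irrelevant.) -/
structure TEStructure where
  D : Fin n → (∀ x, H x) → ∀ x, H x
  Dz : (∀ x, H x) → ∀ x, H x
  /-- the operators are compatible with restriction to open subsets -/
  D_congr : ∀ (W : Set (Base M)) (s s' : ∀ x, H x), IsOpen W → HolSection r s W →
    (∀ x ∈ W, s x = s' x) → ∀ i, ∀ x ∈ W, D i s x = D i s' x
  Dz_congr : ∀ (W : Set (Base M)) (s s' : ∀ x, H x), IsOpen W → HolSection r s W →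
    (∀ x ∈ W, s x = s' x) → ∀ x ∈ W, Dz s x = Dz s' x
  D_hol : ∀ (W : Set (Base M)) (s : ∀ x, H x), IsOpen W → HolSection r s W →
    ∀ i, HolSection r (D i s) W
  Dz_hol : ∀ (W : Set (Base M)) (s : ∀ x, H x), IsOpen W → HolSection r s W →
    HolSection r (Dz s) W
  D_add : ∀ (W : Set (Base M)) (s s' : ∀ x, H x), IsOpen W → HolSection r s W →
    HolSection r s' W → ∀ i, ∀ x ∈ W, D i (fun x => s x + s' x) x = D i s x + D i s' x
  Dz_add : ∀ (W : Set (Base M)) (s s' : ∀ x, H x), IsOpen W → HolSection r s W →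
    HolSection r s' W → ∀ x ∈ W, Dz (fun x => s x + s' x) x = Dz s x + Dz s' x
  /-- the Leibniz rule for `z ∇_{∂ᵢ}` -/
  D_leibniz : ∀ (W : Set (Base M)) (a : ℂ × (Fin n → ℂ) → ℂ) (s : ∀ x, H x), IsOpen W →
    AnalyticOnNhd ℂ a (Subtype.val '' W) → HolSection r s W → ∀ i, ∀ x ∈ W,
      D i (fun x => a x.1 • s x) x =
        (x.1.1 * fderiv ℂ a x.1 (0, Pi.single i 1)) • s x + a x.1 • D i s x
  /-- the Leibniz rule for `z² ∇_{∂_z}` -/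
  Dz_leibniz : ∀ (W : Set (Base M)) (a : ℂ × (Fin n → ℂ) → ℂ) (s : ∀ x, H x), IsOpen W →
    AnalyticOnNhd ℂ a (Subtype.val '' W) → HolSection r s W → ∀ x ∈ W,
      Dz (fun x => a x.1 • s x) x =
        (x.1.1 ^ 2 * fderiv ℂ a x.1 (1, 0)) • s x + a x.1 • Dz s x
  /-- flatness: `∇_{∂ᵢ} ∇_{∂ⱼ} = ∇_{∂ⱼ} ∇_{∂ᵢ}` -/
  flat : ∀ (W : Set (Base M)) (s : ∀ x, H x), IsOpen W → HolSection r s W →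
    ∀ i j, ∀ x ∈ W, D i (D j s) x = D j (D i s) x
  /-- flatness: `∇_{∂_z} ∇_{∂ᵢ} = ∇_{∂ᵢ} ∇_{∂_z}`; multiplied by `z³` this reads
  `Dz (D i s) - z D i s = D i (Dz s)` -/
  flat_z : ∀ (W : Set (Base M)) (s : ∀ x, H x), IsOpen W → HolSection r s W →
    ∀ i, ∀ x ∈ W, Dz (D i s) x - x.1.1 • D i s x = D i (Dz s) x

namespace TEStructure

variable (S : TEStructure r H)

/-- `S` is a (TE)-structure over the F-manifold `M` with Euler field, given by `F`. On
`K = H|_{z=0}`, the operators `z ∇_{∂ᵢ}` and `z² ∇_{∂_z}` induce the Higgs field `C` and the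
endomorphism `𝒰`. The Higgs bundle is primitive, and it induces the multiplication, the unit field
and the Euler field of `F`, i.e. `C_X C_Y = C_{X ∘ Y}`, `C_e = id`, `C_E = - 𝒰`. -/
structure IsOver (F : TangentData n) : Prop where
  primitive : ∃ (W : Set (Base M)) (s : ∀ x, H x), IsOpen W ∧ (∀ t : M, pt 0 t ∈ W) ∧
    HolSection r s W ∧ ∀ t : M, LinearIndependent ℂ (fun i => S.D i s (pt 0 t)) ∧
      Submodule.span ℂ (Set.range fun i => S.D i s (pt 0 t)) = ⊤
  mul : ∀ (W : Set (Base M)) (s : ∀ x, H x), IsOpen W → HolSection r s W →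
    ∀ t : M, pt 0 t ∈ W → ∀ i j,
      S.D i (S.D j s) (pt 0 t) = ∑ k, F.mul t i j k • S.D k s (pt 0 t)
  unit : ∀ (W : Set (Base M)) (s : ∀ x, H x), IsOpen W → HolSection r s W →
    ∀ t : M, pt 0 t ∈ W → ∑ k, F.unit t k • S.D k s (pt 0 t) = s (pt 0 t)
  euler : ∀ (W : Set (Base M)) (s : ∀ x, H x), IsOpen W → HolSection r s W →
    ∀ t : M, pt 0 t ∈ W → ∑ k, F.euler t k • S.D k s (pt 0 t) = - S.Dz s (pt 0 t)

/-- The matrices of the connection in the basis `v` on `W`: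
`∇ v = v · (∑ᵢ z⁻¹ Aᵢ dtᵢ + z⁻² B dz)`, matrices as functions of `(z, t)`. -/
def HasMatrices (v : Fin r → ∀ x, H x) (W : Set (Base M))
    (A : Fin n → ℂ → (Fin n → ℂ) → Matrix (Fin r) (Fin r) ℂ)
    (B : ℂ → (Fin n → ℂ) → Matrix (Fin r) (Fin r) ℂ) : Prop :=
  ∀ x ∈ W, ∀ j, (∀ i, S.D i (v j) x = ∑ k, A i x.1.1 x.1.2 k j • v k x) ∧
    S.Dz (v j) x = ∑ k, B x.1.1 x.1.2 k j • v k x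

/-- The Taylor series at `0` of a matrix valued function. -/
def taylor (B : ℂ → Matrix (Fin r) (Fin r) ℂ) : Matrix (Fin r) (Fin r) (PowerSeries ℂ) :=
  Matrix.of fun i j => PowerSeries.mk fun k =>
    iteratedDeriv k (fun z => B z i j) 0 / (k.factorial : ℂ)

/-- The restriction of the (TE)-structure to the point `t⁰` of `M` decomposes formally into the
rank 1 (TE)-structures `∇ = d - uᵢ z⁻² dz + αᵢ z⁻¹ dz`: near `(0, t⁰)` there are a holomorphic basis
`w` of `H` with `z² ∇_{∂_z} w = w · B` over `t⁰` and an invertible matrix `T` of formal power series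
in `z` such that `w · T` has the diagonal connection matrix `diag(-uᵢ + αᵢ z)`. -/
def FormallyDecomposes (t₀ : M) (u α : Fin r → ℂ) : Prop :=
  ∃ (W : Set (Base M)) (w : Fin r → ∀ x, H x) (B : ℂ → Matrix (Fin r) (Fin r) ℂ)
    (T : Matrix (Fin r) (Fin r) (PowerSeries ℂ)),
    IsOpen W ∧ pt 0 t₀ ∈ W ∧ HolBasis r w W ∧ (∀ i j, AnalyticAt ℂ (fun z => B z i j) 0) ∧
    (∀ z : ℂ, pt z t₀ ∈ W → ∀ j, S.Dz (w j) (pt z t₀) = ∑ k, B z k j • w k (pt z t₀)) ∧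
    IsUnit T ∧
    (PowerSeries.X ^ 2 : PowerSeries ℂ) • T.map (PowerSeries.derivative ℂ) + taylor B * T =
      T * Matrix.diagonal fun i => PowerSeries.C (-u i) + PowerSeries.C (α i) * PowerSeries.X

/-- The regular singular exponents of the (TE)-structure over `t⁰` are the elements of the
multiset `R`: a formal decomposition exists, and each one has these exponents. -/
def HasExponents (t₀ : M) (R : Multiset ℂ) : Prop :=
  (∃ u α, S.FormallyDecomposes t₀ u α) ∧
    ∀ u α, S.FormallyDecomposes t₀ u α → Finset.univ.val.map α = R

/-- `β` is the regular singular exponent at the point `(t⁰, y)` of the analytic spectrum: it belongs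
to the rank 1 piece whose eigenvalue `uᵢ` of `E ∘` is the value `y(E)` at that sheet. -/
def IsExponentAt (F : TangentData n) (t₀ : M) (y : Fin n → ℂ) (β : ℂ) : Prop :=
  ∃ u α, S.FormallyDecomposes t₀ u α ∧ ∃ i, u i = ∑ k, F.euler t₀ k * y k ∧ α i = β

/-- `𝒜^rse(Z) = β`: the regular singular exponent at the points of the component `Z` of `L_M`
outside the bifurcation set is (well-defined and) constantly `β`. -/
def ExponentOn (F : TangentData n) (Z : Set ((Fin n → ℂ) × (Fin n → ℂ))) (β : ℂ) : Prop :=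
  (∃ p ∈ Z, p.1 ∈ M ∧ p.1 ∉ F.bifurcationSet M) ∧
    ∀ (t : M) (y : Fin n → ℂ), ((t : Fin n → ℂ), y) ∈ Z →
      (t : Fin n → ℂ) ∉ F.bifurcationSet M → ∀ γ, S.IsExponentAt F t y γ ↔ γ = β

end TEStructure

end Bundle

/-! ### The normal form over `I₂(m)` -/

/-- The function `f` in the normal form: `0` if `m` is odd, `lam · t₂^((m-4)/2)` if `m` is even. -/
def normalF (m : ℕ) (lam : ℂ) (t : Fin 2 → ℂ) : ℂ :=
  if Even m then lam * t 1 ^ ((m - 4) / 2) else 0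

/-- The matrix `C₂`. -/
def matC2 (m : ℕ) (t : Fin 2 → ℂ) : Matrix (Fin 2) (Fin 2) ℂ := !![0, t 1 ^ (m - 2); 1, 0]

/-- The matrix `D`. -/
def matD : Matrix (Fin 2) (Fin 2) ℂ := !![1, 0; 0, -1]

/-- The matrix `E`. -/
def matE : Matrix (Fin 2) (Fin 2) ℂ := !![0, 1; 0, 0]

/-- The matrices `A₁ = 1` and `A₂ = C₂ + z f E`. -/
def normalA (m : ℕ) (lam : ℂ) : Fin 2 → ℂ → (Fin 2 → ℂ) → Matrix (Fin 2) (Fin 2) ℂ :=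
  ![fun _ _ => 1, fun z t => matC2 m t + (z * normalF m lam t) • matE]

/-- The matrix `B = (-t₁ - (2/m) t₂ C₂) + z (α + (2-m)/(2m) D - (2/m) t₂ f E)`. -/
def normalB (m : ℕ) (α lam : ℂ) (z : ℂ) (t : Fin 2 → ℂ) : Matrix (Fin 2) (Fin 2) ℂ :=
  ((-t 0) • (1 : Matrix (Fin 2) (Fin 2) ℂ) - (2 / (m : ℂ) * t 1) • matC2 m t) +
    z • (α • (1 : Matrix (Fin 2) (Fin 2) ℂ) + ((2 - (m : ℂ)) / (2 * (m : ℂ))) • matD +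
      (-2 / (m : ℂ) * t 1 * normalF m lam t) • matE)

end TE

end

noncomputable section

/-!
Over a point with `t₂ ≠ 0`, in the basis of eigenvectors `(±s, 1)` of `C₂`, where `s² = t₂^(m-2)`,
the `z⁰`-coefficient of the connection matrix is diagonal with the distinct entries `-y(E)`. A
formal gauge transformation then removes all higher terms except the diagonal of the
`z¹`-coefficient, so the exponent at `y = (1, s)` is `α - t₂ f / (m s)`. It is an invariant, because
a formal gauge transformation between two diagonal connections has an invertible constant term,
whose nonzero entries match eigenvalues and exponents.
For odd `m` we have `f = 0`. For even `m = 2k + 2` we have `t₂ f = λ t₂^k` and `s = ±t₂^k`.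

The analytic spectrum is the union of the graphs of `±t₂^k` if `m = 2k + 2`, and the image of
`(t₁, s) ↦ ((t₁, s²), (1, s^(2k+1)))` if `m = 2k + 3`. Each of these is parametrized by a connected
domain, hence irreducible: on a connected domain an analytic subset with an interior point is
everything. In the odd case, the domain is a double covering of `M` branched over `t₂ = 0`, and it
is connected because `M` contains branch points.
-/

namespace TE

/-! ### Irreducibility of analytic sets -/

section Analytic

variable {V V' : Type*} [NormedAddCommGroup V] [NormedSpace ℂ V]
  [NormedAddCommGroup V'] [NormedSpace ℂ V'] {Ω Z Z₁ Z₂ X₁ X₂ : Set V}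

theorem isAnalyticSubset_iff : IsAnalyticSubset Ω Z ↔ Z ⊆ Ω ∧ ∀ p ∈ Ω, ∃ W : Set V,
    IsOpen W ∧ p ∈ W ∧ W ⊆ Ω ∧ ∃ (k : ℕ) (g : Fin k → V → ℂ),
      (∀ i, AnalyticOnNhd ℂ (g i) W) ∧ ∀ x ∈ W, x ∈ Z ↔ ∀ i, g i x = 0 := by
  have mem_iff (W : Set V) (P : V → Prop) : Z ∩ W = {x ∈ W | P x} ↔ ∀ x ∈ W, x ∈ Z ↔ P x := by
    rw [Set.ext_iff]
    refine forall_congr' fun x => ?_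
    rw [Set.mem_inter_iff, Set.mem_ofPred_eq]
    tauto
  simp only [IsAnalyticSubset, mem_iff]

theorem isAnalyticSubset_zeros (hΩ : IsOpen Ω) {k : ℕ} (g : Fin k → V → ℂ)
    (hg : ∀ i, AnalyticOnNhd ℂ (g i) Ω) : IsAnalyticSubset Ω {x ∈ Ω | ∀ i, g i x = 0} :=
  isAnalyticSubset_iff.2 ⟨Set.sep_subset _ _, fun _ hp =>
    ⟨Ω, hΩ, hp, subset_rfl, k, g, hg, fun _ hx => and_iff_right hx⟩⟩

namespace IsAnalyticSubset

theorem inter (h₁ : IsAnalyticSubset Ω Z₁) (h₂ : IsAnalyticSubset Ω Z₂) :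
    IsAnalyticSubset Ω (Z₁ ∩ Z₂) := by
  refine isAnalyticSubset_iff.2 ⟨Set.inter_subset_left.trans h₁.1, fun p hp => ?_⟩
  obtain ⟨W₁, hW₁, hpW₁, hWΩ, k₁, g₁, hg₁, hZ₁⟩ := (isAnalyticSubset_iff.1 h₁).2 p hp
  obtain ⟨W₂, hW₂, hpW₂, -, k₂, g₂, hg₂, hZ₂⟩ := (isAnalyticSubset_iff.1 h₂).2 p hp
  refine ⟨W₁ ∩ W₂, hW₁.inter hW₂, ⟨hpW₁, hpW₂⟩, Set.inter_subset_left.trans hWΩ, k₁ + k₂,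
    Fin.append g₁ g₂, fun i => ?_, fun x hx => ?_⟩
  · induction i using Fin.addCases with
    | left i => simpa using (hg₁ i).mono Set.inter_subset_left
    | right i => simpa using (hg₂ i).mono Set.inter_subset_right
  · simp only [Set.mem_inter_iff, hZ₁ x hx.1, hZ₂ x hx.2, Fin.forall_fin_add, Fin.append_left,
      Fin.append_right]

theorem preimage (h : IsAnalyticSubset Ω Z) {D : Set V'} (hD : IsOpen D) {φ : V' → V}
    (hφ : AnalyticOnNhd ℂ φ D) (hm : Set.MapsTo φ D Ω) : IsAnalyticSubset D (D ∩ φ ⁻¹' Z) := by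
  refine isAnalyticSubset_iff.2 ⟨Set.inter_subset_left, fun p hp => ?_⟩
  obtain ⟨W, hW, hpW, -, k, g, hg, hZ⟩ := (isAnalyticSubset_iff.1 h).2 (φ p) (hm hp)
  exact ⟨D ∩ φ ⁻¹' W, hφ.continuousOn.isOpen_inter_preimage hD hW, ⟨hp, hpW⟩,
    Set.inter_subset_left, k, fun i => g i ∘ φ,
    fun i x hx => (hg i (φ x) hx.2).comp (hφ x hx.1),
    fun x hx => (and_iff_right hx.1).trans (hZ (φ x) hx.2)⟩

theorem isOpen_diff (h : IsAnalyticSubset Ω Z) : IsOpen (Ω \ Z) := by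
  refine isOpen_iff_mem_nhds.2 fun p ⟨hp, hpZ⟩ => ?_
  obtain ⟨W, hW, hpW, hWΩ, k, g, hg, hZ⟩ := (isAnalyticSubset_iff.1 h).2 p hp
  obtain ⟨i, hi⟩ : ∃ i, g i p ≠ 0 := by
    simpa only [not_forall] using mt (hZ p hpW).2 hpZ
  filter_upwards [hW.mem_nhds hpW, (hg i p hpW).continuousAt.eventually_ne hi] with x hxW hx
  exact ⟨hWΩ hxW, fun hxZ => hx ((hZ x hxW).1 hxZ i)⟩

theorem eq_of_interior_nonempty (h : IsAnalyticSubset Ω Z) (hΩ : IsPreconnected Ω)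
    (hi : (interior Z).Nonempty) : Z = Ω := by
  refine h.1.antisymm (Set.Subset.trans ?_ interior_subset)
  obtain ⟨q, hq⟩ := hi
  refine hΩ.subset_of_closure_inter_subset isOpen_interior ⟨q, h.1 (interior_subset hq), hq⟩ ?_
  rintro p ⟨hpZ, hpΩ⟩
  obtain ⟨W, hW, hpW, -, k, g, hg, hZ⟩ := (isAnalyticSubset_iff.1 h).2 p hpΩ
  obtain ⟨ε, hε, hball⟩ := Metric.isOpen_iff.1 hW p hpW
  obtain ⟨x, hx, hxZ⟩ := mem_closure_iff.1 hpZ _ Metric.isOpen_ball (Metric.mem_ball_self hε)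
  have hvanish (i : Fin k) : Set.EqOn (g i) 0 (Metric.ball p ε) := by
    refine ((hg i).mono hball).eqOn_zero_of_preconnected_of_eventuallyEq_zero
      (convex_ball p ε).isPreconnected hx ?_
    filter_upwards [isOpen_interior.mem_nhds hxZ, Metric.isOpen_ball.mem_nhds hx] with y hyZ hy
    exact (hZ y (hball hy)).1 (interior_subset hyZ) i
  exact mem_interior.2 ⟨_, fun y hy => (hZ y (hball hy)).2 fun i => hvanish i hy,
    Metric.isOpen_ball, Metric.mem_ball_self hε⟩

theorem eq_or_eq_of_subset_union (h₁ : IsAnalyticSubset Ω Z₁) (h₂ : IsAnalyticSubset Ω Z₂)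
    (hΩ : IsPreconnected Ω) (h : Ω ⊆ Z₁ ∪ Z₂) : Z₁ = Ω ∨ Z₂ = Ω := by
  rcases (Ω \ Z₁).eq_empty_or_nonempty with hempty | hne
  · exact .inl (h₁.1.antisymm (Set.sdiff_eq_empty.1 hempty))
  · exact .inr (h₂.eq_of_interior_nonempty hΩ
      (hne.mono (interior_maximal (Set.sdiff_subset_iff.2 h) h₁.isOpen_diff)))

theorem isIrreducible_image {D : Set V'} (hDo : IsOpen D) (hD : IsConnected D) {φ : V' → V}
    (hφ : AnalyticOnNhd ℂ φ D) (h : IsAnalyticSubset Ω (φ '' D)) :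
    IsIrreducibleAnalyticSubset Ω (φ '' D) := by
  have hm : Set.MapsTo φ D Ω := fun x hx => h.1 ⟨x, hx, rfl⟩
  refine ⟨h, hD.nonempty.image φ, fun Z₁ Z₂ h₁ h₂ hZ => ?_⟩
  have hcover : D ⊆ D ∩ φ ⁻¹' Z₁ ∪ D ∩ φ ⁻¹' Z₂ := by
    rw [← Set.inter_union_distrib_left, ← Set.preimage_union, ← hZ]
    exact Set.subset_inter subset_rfl (Set.subset_preimage_image φ D)
  refine ((h₁.preimage hDo hφ hm).eq_or_eq_of_subset_union (h₂.preimage hDo hφ hm)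
    hD.isPreconnected hcover).imp (fun hD₁ => ?_) (fun hD₂ => ?_)
  · exact (Set.image_subset_iff.2 (Set.inter_eq_left.1 hD₁)).antisymm
      (hZ ▸ Set.subset_union_left)
  · exact (Set.image_subset_iff.2 (Set.inter_eq_left.1 hD₂)).antisymm
      (hZ ▸ Set.subset_union_right)

end IsAnalyticSubset

theorem IsIrreducibleAnalyticSubset.subset_or_subset (h : IsIrreducibleAnalyticSubset Ω Z)
    (h₁ : IsAnalyticSubset Ω X₁) (h₂ : IsAnalyticSubset Ω X₂) (hZ : Z ⊆ X₁ ∪ X₂) :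
    Z ⊆ X₁ ∨ Z ⊆ X₂ := by
  refine (h.2.2 _ _ (h.1.inter h₁) (h.1.inter h₂) ?_).imp
    (fun h => Set.inter_eq_left.1 h.symm) (fun h => Set.inter_eq_left.1 h.symm)
  rw [← Set.inter_union_distrib_left, Set.inter_eq_left.2 hZ]

theorem components_eq_singleton (h : IsIrreducibleAnalyticSubset Ω Z) :
    components Ω Z = {Z} := by
  ext Y
  rw [components, Set.mem_ofPred_eq, Set.mem_singleton_iff]
  refine ⟨fun hY => hY.prop.2.antisymm (hY.2 ⟨h, subset_rfl⟩ hY.prop.2), ?_⟩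
  rintro rfl
  exact ⟨⟨h, subset_rfl⟩, fun _ hY _ => hY.2⟩

theorem components_union (h₁ : IsIrreducibleAnalyticSubset Ω X₁)
    (h₂ : IsIrreducibleAnalyticSubset Ω X₂) (h₁₂ : ¬ X₁ ⊆ X₂) (h₂₁ : ¬ X₂ ⊆ X₁) :
    components Ω (X₁ ∪ X₂) = {X₁, X₂} := by
  ext Y
  rw [components, Set.mem_ofPred_eq]
  constructor
  · intro hY
    exact (hY.prop.1.subset_or_subset h₁.1 h₂.1 hY.prop.2).imp
      (fun h => h.antisymm (hY.2 ⟨h₁, Set.subset_union_left⟩ h))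
      (fun h => h.antisymm (hY.2 ⟨h₂, Set.subset_union_right⟩ h))
  · rintro (rfl | rfl)
    · exact ⟨⟨h₁, Set.subset_union_left⟩, fun Y' hY' hle =>
        (hY'.1.subset_or_subset h₁.1 h₂.1 hY'.2).resolve_right fun h => h₁₂ (hle.trans h)⟩
    · exact ⟨⟨h₂, Set.subset_union_right⟩, fun Y' hY' hle =>
        (hY'.1.subset_or_subset h₁.1 h₂.1 hY'.2).resolve_left fun h => h₂₁ (hle.trans h)⟩

end Analytic

/-- A branch point `x₀` lies in only one part of a separation `u ∪ v` upstairs. Hence the images of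
`u ∩ σ⁻¹ u` (`σ` being the covering involution) and of `v` would separate `D`. -/
theorem isPreconnected_preimage_of_branchPoint {X Y : Type*} [TopologicalSpace X]
    [TopologicalSpace Y] {q : X → Y} (hq : IsOpenMap q) {σ : X → X} (hσ : Continuous σ)
    (hfib : ∀ x x', q x = q x' ↔ x' = x ∨ x' = σ x) {x₀ : X} (hx₀ : σ x₀ = x₀) {D : Set Y}
    (hD : IsPreconnected D) (hDq : D ⊆ Set.range q) (h₀ : q x₀ ∈ D) :
    IsPreconnected (q ⁻¹' D) := by
  rintro u v hu hv hcov hDu ⟨x, hxD, hxv⟩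
  wlog hx₀u : x₀ ∈ u generalizing u v x
  · obtain ⟨y, hyD, hyu⟩ := hDu
    rw [Set.inter_comm u v]
    exact this v u hv hu (Set.union_comm u v ▸ hcov) ⟨x, hxD, hxv⟩ y hyD hyu
      ((hcov h₀).resolve_left hx₀u)
  have hqσ (w : X) : q (σ w) = q w := ((hfib w _).2 (.inr rfl)).symm
  have hDcov : D ⊆ q '' (u ∩ σ ⁻¹' u) ∪ q '' v := by
    intro y hy
    obtain ⟨w, rfl⟩ := hDq hy
    by_cases hwv : w ∈ v
    · exact .inr ⟨w, hwv, rfl⟩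
    by_cases hσwv : σ w ∈ v
    · exact .inr ⟨σ w, hσwv, hqσ w⟩
    have hσw : σ w ∈ q ⁻¹' D := by rwa [Set.mem_preimage, hqσ]
    exact .inl ⟨w, ⟨(hcov hy).resolve_right hwv, (hcov hσw).resolve_right hσwv⟩, rfl⟩
  obtain ⟨y, hyD, ⟨a, ⟨hau, hσau⟩, rfl⟩, b, hbv, hba⟩ :=
    hD _ _ (hq _ (hu.inter (hu.preimage hσ))) (hq _ hv) hDcov
      ⟨q x₀, h₀, x₀, ⟨hx₀u, by rwa [Set.mem_preimage, hx₀]⟩, rfl⟩ ⟨q x, hxD, x, hxv, rfl⟩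
  refine ⟨b, by rwa [Set.mem_preimage, hba], ?_, hbv⟩
  rcases (hfib a b).1 hba.symm with rfl | rfl
  exacts [hau, hσau]

/-! ### Formal gauge transformations -/

section FormalGauge

open PowerSeries

variable {ι R : Type*} [Fintype ι] [CommRing R]

/-- `P` is a formal gauge transformation from the connection matrix `B` to `B'`: if
`z² ∇_{∂_z} w = w B` then `z² ∇_{∂_z} (w P) = (w P) B'`. -/
def IsFormalGauge (B P B' : Matrix ι ι R⟦X⟧) : Prop :=
  (X ^ 2 : R⟦X⟧) • P.map (derivative R) + B * P = P * B'

theorem map_derivative_mul (P T : Matrix ι ι R⟦X⟧) :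
    (P * T).map (derivative R) = P.map (derivative R) * T + P * T.map (derivative R) := by
  ext1 i j
  simp only [Matrix.map_apply, Matrix.mul_apply, Matrix.add_apply, map_sum, Derivation.leibniz,
    ← Finset.sum_add_distrib, smul_eq_mul]
  exact Finset.sum_congr rfl fun k _ => by ring

theorem IsFormalGauge.mul {B P B' T B'' : Matrix ι ι R⟦X⟧} (h : IsFormalGauge B P B')
    (h' : IsFormalGauge B' T B'') : IsFormalGauge B (P * T) B'' := by
  unfold IsFormalGauge at *
  rw [map_derivative_mul, mul_assoc, ← h', mul_add, ← mul_assoc P B' T, ← h, add_mul, smul_add,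
    Matrix.smul_mul, Matrix.mul_smul, mul_assoc]
  abel

variable [DecidableEq ι]

theorem IsFormalGauge.of_mul {B P B' T B'' : Matrix ι ι R⟦X⟧} (hP : IsUnit P)
    (h : IsFormalGauge B P B') (h' : IsFormalGauge B (P * T) B'') : IsFormalGauge B' T B'' := by
  unfold IsFormalGauge at *
  refine hP.mul_left_cancel ?_
  rw [mul_add, ← mul_assoc P B' T, ← h, ← mul_assoc P T, ← h', map_derivative_mul, add_mul,
    smul_add, Matrix.smul_mul, Matrix.mul_smul, mul_assoc]
  abel

theorem isUnit_of_isUnit_map_constantCoeff {P : Matrix ι ι R⟦X⟧}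
    (h : IsUnit (P.map constantCoeff)) : IsUnit P := by
  rwa [Matrix.isUnit_iff_isUnit_det, isUnit_iff_constantCoeff, RingHom.map_det,
    ← Matrix.isUnit_iff_isUnit_det]

/-- The connection matrix `diag(-uᵢ + αᵢ z)` of a direct sum of the rank 1 pieces
`d - uᵢ z⁻² dz + αᵢ z⁻¹ dz`. -/
def diagMatrix (u α : ι → R) : Matrix ι ι R⟦X⟧ :=
  Matrix.diagonal fun i => C (-u i) + C (α i) * X

theorem eq_and_eq_of_constantCoeff_ne_zero [IsDomain R] {u α u' α' : ι → R}
    {P : Matrix ι ι R⟦X⟧} (h : IsFormalGauge (diagMatrix u α) P (diagMatrix u' α')) {i j : ι}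
    (hij : constantCoeff (P i j) ≠ 0) : u' j = u i ∧ α' j = α i := by
  have hentry : X ^ 2 * derivative R (P i j) + (C (-u i) + C (α i) * X) * P i j =
      P i j * (C (-u' j) + C (α' j) * X) := by
    simpa only [diagMatrix, Matrix.add_apply, Matrix.smul_apply, Matrix.diagonal_mul,
      Matrix.mul_diagonal, smul_eq_mul, Matrix.map_apply] using congrFun (congrFun h i) j
  have hu : u' j = u i := by
    have h0 := congrArg constantCoeff hentry
    simp only [map_add, map_mul, map_pow, constantCoeff_X, constantCoeff_C] at h0
    exact mul_left_cancel₀ hij (by linear_combination h0)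
  have hdiv : X * derivative R (P i j) + C (α i) * P i j = C (α' j) * P i j := by
    rw [hu] at hentry
    exact mul_left_cancel₀ X_ne_zero (by linear_combination hentry)
  have h1 := congrArg constantCoeff hdiv
  simp only [map_add, map_mul, constantCoeff_X, constantCoeff_C] at h1
  exact ⟨hu, mul_left_cancel₀ hij (by linear_combination -h1)⟩

theorem exists_perm_of_isFormalGauge [IsDomain R] {u α u' α' : ι → R} {P : Matrix ι ι R⟦X⟧}
    (hP : IsUnit P) (h : IsFormalGauge (diagMatrix u α) P (diagMatrix u' α')) :
    ∃ σ : Equiv.Perm ι, u' = u ∘ σ ∧ α' = α ∘ σ := by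
  have hdet : (P.map constantCoeff).det ≠ 0 :=
    ((Matrix.isUnit_iff_isUnit_det _).1
      (hP.map (constantCoeff (R := R)).mapMatrix)).ne_zero
  rw [Matrix.det_apply] at hdet
  obtain ⟨σ, -, hσ⟩ := Finset.exists_ne_zero_of_sum_ne_zero hdet
  have hprod : ∏ i, constantCoeff (P (σ i) i) ≠ 0 := fun h0 =>
    hσ (by simp only [Matrix.map_apply, h0, smul_zero])
  have heq (i : ι) := eq_and_eq_of_constantCoeff_ne_zero h
    (Finset.prod_ne_zero_iff.1 hprod i (Finset.mem_univ i))
  exact ⟨σ, funext fun i => (heq i).1, funext fun i => (heq i).2⟩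

end FormalGauge

section FormalDiagonalization

open PowerSeries Finset

theorem exists_forall_eq_of_lt {E : Type*} (Φ : ∀ n, (Fin n → E) → E) :
    ∃ x : ℕ → E, ∀ n, x n = Φ n fun l => x l :=
  ⟨Nat.strongRec fun n ih => Φ n fun l => ih l l.2, fun _ => Nat.strongRec_eq ..⟩

variable {ι K : Type*} [Fintype ι] [DecidableEq ι] [Field K] [CharZero K]

/-- Compare coefficients of `zⁿ⁺¹` in `z² x' + diag(w) x + z G x = 0`. The entries `i ≠ j` of the
coefficient `c (n + 1)` of `x` are given by row `i`; the entry `j` drops out of row `j`, as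
`w j = 0`, and is given by the next coefficient of that row, where `G j j` does not contribute. -/
theorem exists_coeff_recursion (G : Matrix ι ι K⟦X⟧) {w : ι → K} {j : ι}
    (hw : ∀ i ≠ j, w i ≠ 0) (hG : constantCoeff (G j j) = 0) :
    ∃ c : ℕ → ι → K, c 0 = Pi.single j 1 ∧ ∀ n : ℕ,
      (∀ i ≠ j, n * c n i + w i * c (n + 1) i +
        ∑ k, ∑ l ∈ range (n + 1), c l k * coeff (n - l) (G i k) = 0) ∧
      (n + 1) * c (n + 1) j + ∑ k, ∑ l ∈ range (n + 2), c l k * coeff (n + 1 - l) (G j k) = 0 := by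
  let tail (m : ℕ) {n : ℕ} (y : Fin (n + 1) → ι → K) (i : ι) : K :=
    ∑ k, ∑ l, y l k * coeff (m - l) (G i k)
  let off {n : ℕ} (y : Fin (n + 1) → ι → K) (i : ι) : K :=
    -(n * y (Fin.last n) i + tail n y i) / w i
  let next {n : ℕ} (y : Fin (n + 1) → ι → K) : ι → K := Function.update (off y) j
    (-(∑ k ∈ univ.erase j, off y k * constantCoeff (G j k) + tail (n + 1) y j) / (n + 1))
  obtain ⟨c, hc⟩ := exists_forall_eq_of_lt (E := ι → K) fun
    | 0, _ => Pi.single j 1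
    | _ + 1, y => next y
  have htail (n m : ℕ) (i : ι) : tail m (fun l : Fin (n + 1) => c l) i =
      ∑ k, ∑ l ∈ range (n + 1), c l k * coeff (m - l) (G i k) := by
    simp only [tail, sum_range]
  have hoff (n : ℕ) (i : ι) (hi : i ≠ j) :
      c (n + 1) i = off (fun l : Fin (n + 1) => c l) i := by
    rw [hc (n + 1)]
    exact Function.update_of_ne hi _ _
  have hdiag (n : ℕ) : c (n + 1) j = -(∑ k ∈ univ.erase j, c (n + 1) k * constantCoeff (G j k) +
      tail (n + 1) (fun l : Fin (n + 1) => c l) j) / (n + 1) := by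
    rw [sum_congr rfl fun k hk => by rw [hoff n k (ne_of_mem_erase hk)], hc (n + 1)]
    exact Function.update_self _ _ _
  refine ⟨c, hc 0, fun n => ⟨fun i hi => ?_, ?_⟩⟩
  · have hwi := hw i hi
    rw [hoff n i hi, ← htail]
    simp only [off, Fin.val_last]
    field_simp
    ring
  · have hn : (n : K) + 1 ≠ 0 := Nat.cast_add_one_ne_zero n
    simp only [sum_range_succ _ (n + 1), sum_add_distrib, Nat.sub_self]
    rw [← htail, ← add_sum_erase _ _ (mem_univ j), coeff_zero_eq_constantCoeff_apply, hG,
      hdiag n]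
    simp only [coeff_zero_eq_constantCoeff_apply]
    field_simp
    ring

theorem exists_formal_solution (G : Matrix ι ι K⟦X⟧) {w : ι → K} {j : ι} (hwj : w j = 0)
    (hw : ∀ i ≠ j, w i ≠ 0) (hG : constantCoeff (G j j) = 0) :
    ∃ x : ι → K⟦X⟧, (∀ i, constantCoeff (x i) = Pi.single (M := fun _ => K) j 1 i) ∧
      ∀ i, X ^ 2 * derivative K (x i) + C (w i) * x i + X * ∑ k, G i k * x k = 0 := by
  obtain ⟨c, hc0, hc⟩ := exists_coeff_recursion G hw hG
  have hmul (n : ℕ) (i : ι) : coeff n (∑ k, G i k * mk fun l => c l k) =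
      ∑ k, ∑ l ∈ range (n + 1), c l k * coeff (n - l) (G i k) := by
    simp only [map_sum, mul_comm (G i _), coeff_mul, coeff_mk,
      Nat.sum_antidiagonal_eq_sum_range_succ_mk]
  have hderiv (n : ℕ) (i : ι) :
      coeff n (X * derivative K (mk fun l => c l i)) = n * c n i := by
    cases n with
    | zero => simp only [coeff_zero_X_mul, Nat.cast_zero, zero_mul]
    | succ n =>
      rw [coeff_succ_X_mul, coeff_derivative, coeff_mk, Nat.cast_succ, mul_comm]
  refine ⟨fun i => mk fun n => c n i, fun i => by rw [← hc0]; exact constantCoeff_mk, fun i => ?_⟩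
  ext n
  rw [pow_two, mul_assoc]
  cases n with
  | zero =>
    by_cases hi : i = j
    · simp [hi, hwj]
    · simp [hc0, hi]
  | succ n =>
    simp only [map_add, coeff_succ_X_mul, coeff_C_mul, coeff_mk, hmul, hderiv, map_zero]
    by_cases hi : i = j
    · subst hi
      cases n with
      | zero => simp [hwj, hc0, Pi.single_apply, hG]
      | succ n => simpa [hwj] using (hc n).2
    · exact (hc n).1 i hi

theorem exists_isFormalGauge_diagMatrix {B : Matrix ι ι K⟦X⟧} {u : ι → K}
    (hB : B.map constantCoeff = Matrix.diagonal fun i => -u i) (hu : Function.Injective u) :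
    ∃ T, IsUnit T ∧ IsFormalGauge B T (diagMatrix u fun i => coeff 1 (B i i)) := by
  choose N hN using fun i k => X_dvd_iff.2
    (show constantCoeff (B i k - C (Matrix.diagonal (fun i => -u i) i k)) = 0 by
      rw [← hB, map_sub, constantCoeff_C, Matrix.map_apply, sub_self])
  have hBN (i k : ι) : B i k = X * N i k + C (Matrix.diagonal (fun i => -u i) i k) :=
    sub_eq_iff_eq_add.1 (hN i k)
  have hα (i : ι) : coeff 1 (B i i) = constantCoeff (N i i) := by
    simp [hBN i i]
  choose x hx0 hx using fun j => exists_formal_solution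
    (G := Matrix.of N - Matrix.diagonal fun _ => C (coeff 1 (B j j))) (w := fun i => u j - u i)
    (j := j) (sub_self _) (fun i hi => sub_ne_zero.2 (hu.ne hi.symm)) (by simp [hα])
  refine ⟨Matrix.of fun i j => x j i, isUnit_of_isUnit_map_constantCoeff ?_, ?_⟩
  · convert isUnit_one using 1
    ext i j
    simp [hx0, Matrix.one_apply, Pi.single_apply]
  · ext1 i j
    have hBx : ∑ k, B i k * x j k = X * ∑ k, N i k * x j k - C (u i) * x j i := by
      simp [hBN, add_mul, sum_add_distrib, mul_sum, mul_assoc, Matrix.diagonal_apply, apply_ite C,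
        sub_eq_add_neg]
    have hGx := hx j i
    simp only [Matrix.sub_apply, Matrix.of_apply, Matrix.diagonal_apply, sub_mul, ite_mul, zero_mul,
      sum_sub_distrib, sum_ite_eq, mem_univ, if_true, map_sub] at hGx
    rw [diagMatrix, Matrix.mul_diagonal]
    simp only [Matrix.add_apply, Matrix.smul_apply, Matrix.map_apply, smul_eq_mul,
      Matrix.mul_apply, Matrix.of_apply, hBx, map_neg]
    linear_combination hGx

end FormalDiagonalization

section Taylor

open Filter Topology PowerSeries

variable {𝕜 : Type*} [NontriviallyNormedField 𝕜]

/-- The Taylor series of `f` at `0`. -/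
def taylorSeries (f : 𝕜 → 𝕜) : 𝕜⟦X⟧ :=
  PowerSeries.mk fun k => iteratedDeriv k f 0 / (k.factorial : 𝕜)

variable {f g : 𝕜 → 𝕜}

theorem taylorSeries_congr (h : f =ᶠ[𝓝 0] g) : taylorSeries f = taylorSeries g := by
  ext k
  simp only [taylorSeries, coeff_mk, h.iteratedDeriv_eq k]

theorem constantCoeff_taylorSeries (f : 𝕜 → 𝕜) : constantCoeff (taylorSeries f) = f 0 := by
  simp [taylorSeries, constantCoeff_mk]

theorem coeff_one_taylorSeries (f : 𝕜 → 𝕜) : coeff 1 (taylorSeries f) = deriv f 0 := by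
  simp [taylorSeries]

theorem taylorSeries_zero : taylorSeries (fun _ : 𝕜 => 0) = 0 := by
  ext k
  simp [taylorSeries]

theorem taylorSeries_id : taylorSeries (fun z : 𝕜 => z) = X := by
  ext k
  rcases k with _ | _ | k
  · simp [taylorSeries]
  · simp [taylorSeries]
  · simp [taylorSeries, coeff_X, iteratedDeriv_succ', iteratedDeriv_const]

theorem taylorSeries_add [CompleteSpace 𝕜] (hf : AnalyticAt 𝕜 f 0) (hg : AnalyticAt 𝕜 g 0) :
    taylorSeries (fun z => f z + g z) = taylorSeries f + taylorSeries g := by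
  ext k
  simp [taylorSeries, iteratedDeriv_fun_add hf.contDiffAt hg.contDiffAt, add_div]

theorem taylorSeries_sum [CompleteSpace 𝕜] {ι : Type*} (s : Finset ι) {f : ι → 𝕜 → 𝕜}
    (hf : ∀ i, AnalyticAt 𝕜 (f i) 0) :
    taylorSeries (fun z => ∑ i ∈ s, f i z) = ∑ i ∈ s, taylorSeries (f i) := by
  classical
  induction s using Finset.induction_on with
  | empty => exact taylorSeries_zero
  | insert a s ha ih =>
    simp only [Finset.sum_insert ha]
    rw [taylorSeries_add (hf a) (s.analyticAt_fun_sum fun i _ => hf i), ih]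

variable [CharZero 𝕜]

theorem taylorSeries_mul [CompleteSpace 𝕜] (hf : AnalyticAt 𝕜 f 0) (hg : AnalyticAt 𝕜 g 0) :
    taylorSeries (fun z => f z * g z) = taylorSeries f * taylorSeries g := by
  ext k
  simp only [taylorSeries, coeff_mk, iteratedDeriv_fun_mul hf.contDiffAt hg.contDiffAt, coeff_mul,
    Finset.Nat.sum_antidiagonal_eq_sum_range_succ_mk, Nat.succ_eq_add_one, Finset.sum_div]
  refine Finset.sum_congr rfl fun i hi => ?_
  rw [Nat.cast_choose _ (Finset.mem_range_succ_iff.1 hi)]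
  field_simp [Nat.factorial_ne_zero]

theorem derivative_taylorSeries (f : 𝕜 → 𝕜) :
    derivative 𝕜 (taylorSeries f) = taylorSeries (deriv f) := by
  ext k
  have hk : (k : 𝕜) + 1 ≠ 0 := Nat.cast_add_one_ne_zero k
  have hfac : (k.factorial : 𝕜) ≠ 0 := Nat.cast_ne_zero.2 k.factorial_ne_zero
  simp only [coeff_derivative, taylorSeries, coeff_mk, iteratedDeriv_succ', Nat.factorial_succ,
    Nat.cast_mul, Nat.cast_succ]
  field_simp

end Taylor

section MatrixTaylor

open Filter Topology PowerSeries TEStructure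

variable {r : ℕ} {B P B' : ℂ → Matrix (Fin r) (Fin r) ℂ}

theorem taylor_apply (B : ℂ → Matrix (Fin r) (Fin r) ℂ) (i j : Fin r) :
    taylor B i j = taylorSeries fun z => B z i j := rfl

theorem map_constantCoeff_taylor (B : ℂ → Matrix (Fin r) (Fin r) ℂ) :
    (taylor B).map constantCoeff = B 0 := by
  ext i j
  exact constantCoeff_taylorSeries _

theorem isUnit_taylor (h : IsUnit (P 0)) : IsUnit (taylor P) :=
  isUnit_of_isUnit_map_constantCoeff (by rwa [map_constantCoeff_taylor])

theorem analyticAt_mul_apply (hB : ∀ i j, AnalyticAt ℂ (fun z => B z i j) 0)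
    (hP : ∀ i j, AnalyticAt ℂ (fun z => P z i j) 0) (i j : Fin r) :
    AnalyticAt ℂ (fun z => (B z * P z) i j) 0 := by
  simp only [Matrix.mul_apply]
  exact Finset.univ.analyticAt_fun_sum fun k _ => (hB i k).fun_mul (hP k j)

theorem taylor_mul (hB : ∀ i j, AnalyticAt ℂ (fun z => B z i j) 0)
    (hP : ∀ i j, AnalyticAt ℂ (fun z => P z i j) 0) :
    taylor (fun z => B z * P z) = taylor B * taylor P := by
  ext1 i j
  simp only [Matrix.mul_apply, taylor_apply]
  rw [taylorSeries_sum _ fun k => (hB i k).fun_mul (hP k j)]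
  exact Finset.sum_congr rfl fun k _ => taylorSeries_mul (hB i k) (hP k j)

theorem isFormalGauge_taylor (hB : ∀ i j, AnalyticAt ℂ (fun z => B z i j) 0)
    (hP : ∀ i j, AnalyticAt ℂ (fun z => P z i j) 0)
    (hB' : ∀ i j, AnalyticAt ℂ (fun z => B' z i j) 0)
    (h : ∀ᶠ z in 𝓝 0, z ^ 2 • Matrix.of (fun i j => deriv (fun z => P z i j) z) + B z * P z =
      P z * B' z) :
    IsFormalGauge (taylor B) (taylor P) (taylor B') := by
  have hsq : AnalyticAt ℂ (fun z : ℂ => z ^ 2) 0 := by fun_prop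
  have htaylor_sq : taylorSeries (fun z : ℂ => z ^ 2) = X ^ 2 := by
    simp only [pow_two]
    rw [taylorSeries_mul (by fun_prop) (by fun_prop), taylorSeries_id]
  unfold IsFormalGauge
  ext1 i j
  rw [← taylor_mul hP hB', ← taylor_mul hB hP, Matrix.add_apply, Matrix.smul_apply,
    Matrix.map_apply, taylor_apply, taylor_apply, taylor_apply, derivative_taylorSeries,
    smul_eq_mul, ← htaylor_sq, ← taylorSeries_mul hsq (hP i j).deriv,
    ← taylorSeries_add (hsq.fun_mul (hP i j).deriv) (analyticAt_mul_apply hB hP i j)]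
  refine taylorSeries_congr ?_
  filter_upwards [h] with z hz
  exact congrFun (congrFun hz i) j

theorem exists_isFormalGauge_taylor_of_mul_eq {P N : Matrix (Fin r) (Fin r) ℂ} {u : Fin r → ℂ}
    (hB : ∀ i j, AnalyticAt ℂ (fun z => B z i j) 0) (hP : IsUnit P) (hu : Function.Injective u)
    (h : ∀ z, B z * P = P * (Matrix.diagonal (fun i => -u i) + z • N)) :
    ∃ T, IsUnit T ∧ IsFormalGauge (taylor B) T (diagMatrix u N.diag) := by
  have hgauge : IsFormalGauge (taylor B) (taylor fun _ => P)
      (taylor fun z => Matrix.diagonal (fun i => -u i) + z • N) := by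
    refine isFormalGauge_taylor hB (fun _ _ => analyticAt_const) (fun i j => ?_)
      (.of_forall fun z => ?_)
    · simp only [Matrix.add_apply, Matrix.smul_apply, smul_eq_mul]
      fun_prop
    · ext i j
      simp [h]
  obtain ⟨T, hT, hNT⟩ := exists_isFormalGauge_diagMatrix
    (B := taylor fun z => Matrix.diagonal (fun i => -u i) + z • N)
    (by simp only [map_constantCoeff_taylor, zero_smul, add_zero]) hu
  have hdiag : (fun i => coeff 1 (taylor (fun z => Matrix.diagonal (fun i => -u i) + z • N) i i)) =
      N.diag := by
    ext i
    simp [taylor_apply, coeff_one_taylorSeries]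
  rw [hdiag] at hNT
  exact ⟨_, (isUnit_taylor (P := fun _ => P) hP).mul hT, hgauge.mul hNT⟩

end MatrixTaylor

/-! ### Connection matrices over a point of the base -/

section AnalyticCoordinates

variable {𝕜 : Type*} [NontriviallyNormedField 𝕜]
  {E F : Type*} [NormedAddCommGroup E] [NormedSpace 𝕜 E] [NormedAddCommGroup F] [NormedSpace 𝕜 F]
  {U : TopologicalSpace.Opens E} {W : Set U}

theorem contMDiffOn_of_analyticOnNhd [CompleteSpace F] {a : E → F}
    (ha : AnalyticOnNhd 𝕜 a (Subtype.val '' W)) :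
    ContMDiffOn 𝓘(𝕜, E) 𝓘(𝕜, F) ω (fun x : U => a x) W := fun x hx =>
  (contMDiffAt_subtype_iff.2
    (contMDiffAt_iff_contDiffAt.2 (ha x ⟨x, hx, rfl⟩).contDiffAt)).contMDiffWithinAt

theorem exists_analyticOnNhd_of_contMDiffOn (hW : IsOpen W) {g : U → F}
    (hg : ContMDiffOn 𝓘(𝕜, E) 𝓘(𝕜, F) ω g W) :
    ∃ a : E → F, AnalyticOnNhd 𝕜 a (Subtype.val '' W) ∧ ∀ x : U, a x = g x := by
  have hext : (fun x : U => Function.extend Subtype.val g 0 (x : E)) = g :=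
    funext fun x => Subtype.val_injective.extend_apply g 0 x
  refine ⟨Function.extend Subtype.val g 0, ?_, congrFun hext⟩
  rintro _ ⟨x, hx, rfl⟩
  have h := hg.contMDiffAt (hW.mem_nhds hx)
  rw [← hext] at h
  exact (contMDiffAt_iff_contDiffAt.1 (contMDiffAt_subtype_iff.1 h)).analyticAt

end AnalyticCoordinates

theorem isUnit_of_linearIndependent {ι K E : Type*} [Fintype ι] [DecidableEq ι] [Field K]
    [AddCommGroup E] [Module K E] {f w : ι → E} {a : Matrix ι ι K}
    (hw : LinearIndependent K w) (h : ∀ j, w j = ∑ k, a k j • f k) : IsUnit a := by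
  refine Matrix.mulVec_injective_iff_isUnit.1
    ((injective_iff_map_eq_zero a.mulVecLin).2 fun c hc => ?_)
  refine funext (Fintype.linearIndependent_iff.1 hw c ?_)
  calc ∑ j, c j • w j = ∑ k, (a.mulVec c) k • f k := by
        simp only [h, Finset.smul_sum, smul_smul, Matrix.mulVec, dotProduct, Finset.sum_smul]
        rw [Finset.sum_comm]
        simp only [mul_comm]
    _ = 0 := Finset.sum_eq_zero fun k _ => by
        rw [← Matrix.mulVecLin_apply, hc, Pi.zero_apply, zero_smul]

theorem analyticAt_slice {E F : Type*} [NormedAddCommGroup E] [NormedSpace ℂ E]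
    [NormedAddCommGroup F] [NormedSpace ℂ F] {a : ℂ × E → F} {z : ℂ} {t : E}
    (ha : AnalyticAt ℂ a (z, t)) : AnalyticAt ℂ (fun z => a (z, t)) z :=
  ha.comp (f := fun z : ℂ => (z, t)) (analyticAt_id.prod analyticAt_const)

theorem deriv_slice {E F : Type*} [NormedAddCommGroup E] [NormedSpace ℂ E]
    [NormedAddCommGroup F] [NormedSpace ℂ F] {a : ℂ × E → F} {z : ℂ} {t : E}
    (ha : DifferentiableAt ℂ a (z, t)) :
    deriv (fun z => a (z, t)) z = fderiv ℂ a (z, t) (1, 0) :=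
  (ha.hasFDerivAt.comp_hasDerivAt z
    ((hasDerivAt_id z).prodMk (hasDerivAt_const z t))).deriv

section Bundle

open Filter Topology

variable {n r : ℕ} {M : TopologicalSpace.Opens (Fin n → ℂ)}

theorem eventually_pt_mem {W : Set (Base M)} (hW : IsOpen W) {t : M} (h : pt 0 t ∈ W) :
    ∀ᶠ z in 𝓝 (0 : ℂ), pt z t ∈ W := by
  have hc : Continuous fun z : ℂ => pt z t := Continuous.subtype_mk (by fun_prop) _
  exact hc.continuousAt.eventually (hW.mem_nhds h)

variable {H : Base M → Type*} [TopologicalSpace (Bundle.TotalSpace (Fin r → ℂ) H)]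
  [∀ x, AddCommGroup (H x)] [∀ x, Module ℂ (H x)] [∀ x, TopologicalSpace (H x)]
  [FiberBundle (Fin r → ℂ) H]

namespace TEStructure

variable (S : TEStructure r H)

/-- `B` is a connection matrix over `t⁰`: near `(0, t⁰)` there is a holomorphic basis `w` of `H`
with `z² ∇_{∂_z} w = w · B` over `t⁰`. -/
def IsSliceMatrix (t₀ : M) (B : ℂ → Matrix (Fin r) (Fin r) ℂ) : Prop :=
  ∃ (W : Set (Base M)) (w : Fin r → ∀ x, H x), IsOpen W ∧ pt 0 t₀ ∈ W ∧ HolBasis r w W ∧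
    (∀ i j, AnalyticAt ℂ (fun z => B z i j) 0) ∧
    ∀ z : ℂ, pt z t₀ ∈ W → ∀ j, S.Dz (w j) (pt z t₀) = ∑ k, B z k j • w k (pt z t₀)

variable {S} in
theorem formallyDecomposes_iff {t₀ : M} {u α : Fin r → ℂ} : S.FormallyDecomposes t₀ u α ↔
    ∃ B T, S.IsSliceMatrix t₀ B ∧ IsUnit T ∧ IsFormalGauge (taylor B) T (diagMatrix u α) := by
  constructor
  · rintro ⟨W, w, B, T, hW, h0W, hw, hB, hwB, hT, hg⟩
    exact ⟨B, T, ⟨W, w, hW, h0W, hw, hB, hwB⟩, hT, hg⟩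
  · rintro ⟨B, T, ⟨W, w, hW, h0W, hw, hB, hwB⟩, hT, hg⟩
    exact ⟨W, w, B, T, hW, h0W, hw, hB, hwB, hT, hg⟩

end TEStructure

variable [VectorBundle ℂ (Fin r → ℂ) H]

theorem HolSection.sum {ι : Type*} (σ : Finset ι) {s : ι → ∀ x, H x} {W : Set (Base M)}
    (hs : ∀ i, HolSection r (s i) W) : HolSection r (fun x => ∑ i ∈ σ, s i x) W :=
  ContMDiffOn.sum_section fun i _ => hs i

theorem HolSection.smul {W : Set (Base M)} {a : ℂ × (Fin n → ℂ) → ℂ}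
    (ha : AnalyticOnNhd ℂ a (Subtype.val '' W)) {s : ∀ x, H x} (hs : HolSection r s W) :
    HolSection r (fun x => a x.1 • s x) W :=
  (contMDiffOn_of_analyticOnNhd ha).smul_section hs

theorem exists_holBasis_forall_exists_eq_sum
    [ContMDiffVectorBundle ω (Fin r → ℂ) H 𝓘(ℂ, ℂ × (Fin n → ℂ))] (x₀ : Base M) :
    ∃ (U : Set (Base M)) (f : Fin r → ∀ x, H x), IsOpen U ∧ x₀ ∈ U ∧ HolBasis r f U ∧
      ∀ (W : Set (Base M)) (w : Fin r → ∀ x, H x), IsOpen W → W ⊆ U →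
        (∀ j, HolSection r (w j) W) → ∃ a : ℂ × (Fin n → ℂ) → Matrix (Fin r) (Fin r) ℂ,
          (∀ k j, AnalyticOnNhd ℂ (fun p => a p k j) (Subtype.val '' W)) ∧
          ∀ x ∈ W, ∀ j, w j x = ∑ k, a x.1 k j • f k x := by
  let e := trivializationAt (Fin r → ℂ) H x₀
  let b := Pi.basisFun ℂ (Fin r)
  refine ⟨e.baseSet, e.localFrame b, e.open_baseSet,
    FiberBundle.mem_baseSet_trivializationAt' x₀,
    e.isLocalFrameOn_localFrame_baseSet 𝓘(ℂ, ℂ × (Fin n → ℂ)) ω b, fun W w hW hWU hw => ?_⟩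
  choose a ha hae using fun k j => exists_analyticOnNhd_of_contMDiffOn hW
    (contMDiffOn_localFrameCoeff (I := 𝓘(ℂ, ℂ × (Fin n → ℂ))) b hW hWU (hw j) k)
  refine ⟨fun p => Matrix.of fun k j => a k j p, ha, fun x hx j => ?_⟩
  simp only [Matrix.of_apply, hae]
  exact e.eq_sum_localFrameCoeff_smul (I := 𝓘(ℂ, ℂ × (Fin n → ℂ))) (hWU hx)

namespace TEStructure

variable (S : TEStructure r H)

theorem Dz_sum {ι : Type*} (σ : Finset ι) {s : ι → ∀ x, H x} {W : Set (Base M)} (hW : IsOpen W)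
    (hs : ∀ i, HolSection r (s i) W) {x : Base M} (hx : x ∈ W) :
    S.Dz (fun x => ∑ i ∈ σ, s i x) x = ∑ i ∈ σ, S.Dz (s i) x := by
  classical
  induction σ using Finset.induction_on with
  | empty =>
    have h0 : HolSection r (fun x : Base M => (0 : H x)) W := by
      simpa using HolSection.sum (∅ : Finset ι) hs
    simpa using S.Dz_add W _ _ hW h0 h0 x hx
  | insert i σ hi ih =>
    simp only [Finset.sum_insert hi]
    rw [S.Dz_add W _ _ hW (hs i) (HolSection.sum σ hs) x hx, ih]

section ChangeOfBasis

variable {S} {W : Set (Base M)} {f w : Fin r → ∀ x, H x}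
  {a : ℂ × (Fin n → ℂ) → Matrix (Fin r) (Fin r) ℂ}

theorem Dz_eq_sum_of_eq_sum (hW : IsOpen W) (hf : ∀ k, HolSection r (f k) W)
    (hw : ∀ j, HolSection r (w j) W)
    (ha : ∀ k j, AnalyticOnNhd ℂ (fun p => a p k j) (Subtype.val '' W))
    (hwf : ∀ x ∈ W, ∀ j, w j x = ∑ k, a x.1 k j • f k x) {x : Base M} (hx : x ∈ W)
    {b : Matrix (Fin r) (Fin r) ℂ} (hb : ∀ j, S.Dz (f j) x = ∑ k, b k j • f k x) (j : Fin r) :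
    S.Dz (w j) x =
      ∑ k, (x.1.1 ^ 2 * fderiv ℂ (fun p => a p k j) x.1 (1, 0) + (b * a x.1) k j) • f k x := by
  rw [S.Dz_congr W _ _ hW (hw j) (fun x hx => hwf x hx j) x hx,
    S.Dz_sum Finset.univ hW (fun k => HolSection.smul (ha k j) (hf k)) hx]
  simp only [fun k => S.Dz_leibniz W _ (f k) hW (ha k j) (hf k) x hx, hb, Matrix.mul_apply,
    add_smul, Finset.sum_add_distrib, Finset.sum_smul, Finset.smul_sum, smul_smul, mul_comm]
  rw [Finset.sum_comm (γ := Fin r)]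

theorem connectionMatrix_change (hW : IsOpen W) (hf : HolBasis r f W)
    (hw : ∀ j, HolSection r (w j) W)
    (ha : ∀ k j, AnalyticOnNhd ℂ (fun p => a p k j) (Subtype.val '' W))
    (hwf : ∀ x ∈ W, ∀ j, w j x = ∑ k, a x.1 k j • f k x) {x : Base M} (hx : x ∈ W)
    {b B : Matrix (Fin r) (Fin r) ℂ} (hb : ∀ j, S.Dz (f j) x = ∑ k, b k j • f k x)
    (hB : ∀ j, S.Dz (w j) x = ∑ k, B k j • w k x) :
    x.1.1 ^ 2 • Matrix.of (fun k j => fderiv ℂ (fun p => a p k j) x.1 (1, 0)) + b * a x.1 =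
      a x.1 * B := by
  ext k j
  have hDz : S.Dz (w j) x = ∑ k, (a x.1 * B) k j • f k x := by
    simp only [hB, hwf x hx, Matrix.mul_apply, Finset.smul_sum, Finset.sum_smul, smul_smul,
      mul_comm]
    rw [Finset.sum_comm]
  exact (hf.linearIndependent hx).eq_coords_of_eq
    ((Dz_eq_sum_of_eq_sum hW hf.contMDiffOn hw ha hwf hx hb j).symm.trans hDz) k

end ChangeOfBasis

variable {S} {t₀ : M} [ContMDiffVectorBundle ω (Fin r → ℂ) H 𝓘(ℂ, ℂ × (Fin n → ℂ))]

variable (S t₀) in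
theorem exists_forall_isSliceMatrix_exists_isFormalGauge :
    ∃ Q : Matrix (Fin r) (Fin r) (PowerSeries ℂ), ∀ B, S.IsSliceMatrix t₀ B →
      ∃ P, IsUnit P ∧ IsFormalGauge Q P (taylor B) := by
  obtain ⟨U, f, hU, h0U, hf, hexpand⟩ :=
    exists_holBasis_forall_exists_eq_sum (r := r) (H := H) (pt 0 t₀)
  obtain ⟨b, hb, hfb⟩ :=
    hexpand U (fun j => S.Dz (f j)) hU subset_rfl fun j => S.Dz_hol U _ hU (hf.contMDiffOn j)
  refine ⟨taylor fun z => b (z, t₀), ?_⟩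
  rintro B ⟨W, w, hW, h0W, hw, hB, hwB⟩
  have hWU : IsOpen (W ∩ U) := hW.inter hU
  have h0 : pt 0 t₀ ∈ W ∩ U := ⟨h0W, h0U⟩
  have hw' (j : Fin r) : HolSection r (w j) (W ∩ U) :=
    (hw.contMDiffOn j).mono Set.inter_subset_left
  obtain ⟨a, ha, hwa⟩ := hexpand (W ∩ U) w hWU Set.inter_subset_right hw'
  refine ⟨taylor fun z => a (z, t₀),
    isUnit_taylor (isUnit_of_linearIndependent (hw.linearIndependent h0W) (hwa _ h0)),
    isFormalGauge_taylor (fun i j => analyticAt_slice (hb i j _ ⟨_, h0U, rfl⟩))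
      (fun i j => analyticAt_slice (ha i j _ ⟨_, h0, rfl⟩)) hB ?_⟩
  filter_upwards [eventually_pt_mem hWU h0] with z hz
  have hda (i j : Fin r) : deriv (fun z => a (z, t₀) i j) z =
      fderiv ℂ (fun p => a p i j) (z, t₀) (1, 0) :=
    deriv_slice (a := fun p => a p i j) (ha i j _ ⟨_, hz, rfl⟩).differentiableAt
  simp only [hda]
  exact connectionMatrix_change hWU (hf.mono Set.inter_subset_right) hw' ha hwa hz
    (hfb _ hz.2) (hwB z hz.1)

namespace FormallyDecomposes

variable {u α : Fin r → ℂ}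

theorem exists_perm {u' α' : Fin r → ℂ} (h : S.FormallyDecomposes t₀ u α)
    (h' : S.FormallyDecomposes t₀ u' α') :
    ∃ σ : Equiv.Perm (Fin r), u' = u ∘ σ ∧ α' = α ∘ σ := by
  obtain ⟨Q, hQ⟩ := S.exists_forall_isSliceMatrix_exists_isFormalGauge t₀
  have key {u α : Fin r → ℂ} (h : S.FormallyDecomposes t₀ u α) :
      ∃ T, IsUnit T ∧ IsFormalGauge Q T (diagMatrix u α) := by
    obtain ⟨B, T, hB, hT, hBT⟩ := formallyDecomposes_iff.1 h
    obtain ⟨P, hP, hQP⟩ := hQ B hB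
    exact ⟨P * T, hP.mul hT, hQP.mul hBT⟩
  obtain ⟨T, hT, hQT⟩ := key h
  obtain ⟨T', hT', hQT'⟩ := key h'
  obtain ⟨R, rfl⟩ := hT.dvd (a := T')
  exact exists_perm_of_isFormalGauge (hT.mul_left_iff.1 hT') (hQT.of_mul hT hQT')

theorem hasExponents (h : S.FormallyDecomposes t₀ u α) :
    S.HasExponents t₀ (Finset.univ.val.map α) := by
  refine ⟨⟨u, α, h⟩, fun u' α' h' => ?_⟩
  obtain ⟨σ, -, rfl⟩ := h.exists_perm h'
  rw [← Multiset.map_map, Multiset.map_univ_val_equiv]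

theorem isExponentAt_iff (h : S.FormallyDecomposes t₀ u α) (hu : Function.Injective u)
    {F : TangentData n} {y : Fin n → ℂ} {i : Fin r} (hi : u i = ∑ k, F.euler t₀ k * y k) (γ : ℂ) :
    S.IsExponentAt F t₀ y γ ↔ γ = α i := by
  constructor
  · rintro ⟨u', α', h', j, hj, rfl⟩
    obtain ⟨σ, rfl, rfl⟩ := h.exists_perm h'
    exact congrArg α (hu (hj.trans hi.symm))
  · rintro rfl
    exact ⟨u, α, h, i, hi, rfl⟩

end FormallyDecomposes

end TEStructure

end Bundle

/-! ### The analytic spectrum of `I₂(m)` -/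

section Spectrum

variable {M : TopologicalSpace.Opens (Fin 2 → ℂ)} {m k : ℕ}

theorem mem_spectrum_I2 {p : (Fin 2 → ℂ) × (Fin 2 → ℂ)} :
    p ∈ (I2 m).spectrum M ↔ p.1 ∈ M ∧ p.2 0 = 1 ∧ p.2 1 ^ 2 = p.1 1 ^ (m - 2) := by
  simp only [TangentData.spectrum, I2, Fin.sum_univ_two, Fin.forall_fin_two, Set.mem_ofPred_eq,
    Matrix.cons_val_zero, Matrix.cons_val_one, one_mul, zero_mul, add_zero, zero_add]
  constructor
  · rintro ⟨hM, hy, -, -, hsq⟩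
    rw [hy, mul_one, ← pow_two] at hsq
    exact ⟨hM, hy, hsq⟩
  · rintro ⟨hM, hy, hsq⟩
    rw [hy, mul_one, mul_one, mul_one, one_mul, ← pow_two]
    exact ⟨hM, rfl, ⟨rfl, rfl⟩, rfl, hsq⟩

theorem isAnalyticSubset_spectrum_I2 :
    IsAnalyticSubset ((M : Set (Fin 2 → ℂ)) ×ˢ Set.univ) ((I2 m).spectrum M) := by
  convert isAnalyticSubset_zeros (M.isOpen.prod isOpen_univ)
    ![fun p : (Fin 2 → ℂ) × (Fin 2 → ℂ) => p.2 0 - 1, fun p => p.2 1 ^ 2 - p.1 1 ^ (m - 2)] ?_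
    using 1
  · ext p
    simp [mem_spectrum_I2, Fin.forall_fin_two, sub_eq_zero]
  · intro i p _
    fin_cases i <;> exact ContDiffAt.analyticAt (by dsimp; fun_prop)

/-- The value `y(E)` of the Euler field of `I₂(m)` at the point `y = (1, s)` over `t`. -/
def sheetValue (m : ℕ) (t : Fin 2 → ℂ) (s : ℂ) : ℂ :=
  t 0 + 2 / m * t 1 * s

theorem sum_euler_I2_mul {t y : Fin 2 → ℂ} (hy : y 0 = 1) :
    ∑ i, (I2 m).euler t i * y i = sheetValue m t (y 1) := by
  simp [I2, sheetValue, Fin.sum_univ_two, hy]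

theorem sheetValue_eq_sheetValue_neg_iff (hm : m ≠ 0) {t : Fin 2 → ℂ} {s : ℂ} :
    sheetValue m t s = sheetValue m t (-s) ↔ t 1 = 0 ∨ s = 0 := by
  have hm' : (m : ℂ) ≠ 0 := Nat.cast_ne_zero.2 hm
  have hdiff : sheetValue m t s - sheetValue m t (-s) = 4 / m * (t 1 * s) := by
    unfold sheetValue
    ring
  rw [← sub_eq_zero, hdiff, mul_eq_zero, mul_eq_zero, or_iff_right (by simp [hm'])]

theorem roots_charpoly_eulerMatrix_I2 {t : Fin 2 → ℂ} {s : ℂ} (hs : s ^ 2 = t 1 ^ (m - 2)) :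
    ((I2 m).eulerMatrix t).charpoly.roots = {sheetValue m t s, sheetValue m t (-s)} := by
  have hmat : (I2 m).eulerMatrix t =
      !![t 0, 2 / (m : ℂ) * t 1 * s ^ 2; 2 / (m : ℂ) * t 1, t 0] := by
    rw [hs]
    ext i j
    fin_cases i <;> fin_cases j <;> simp [TangentData.eulerMatrix, I2, Fin.sum_univ_two]
  have hchar : ((I2 m).eulerMatrix t).charpoly = (({sheetValue m t s, sheetValue m t (-s)} :
      Multiset ℂ).map fun a => Polynomial.X - Polynomial.C a).prod := by
    rw [Matrix.charpoly_fin_two, hmat, Matrix.det_fin_two_of, Matrix.trace_fin_two_of]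
    simp only [sheetValue, Multiset.insert_eq_cons, Multiset.map_cons, Multiset.map_singleton,
      Multiset.prod_cons, Multiset.prod_singleton, map_add, map_sub, map_mul, map_pow, map_neg]
    ring
  rw [hchar, Polynomial.roots_multiset_prod_X_sub_C]

theorem notMem_bifurcationSet_I2 (hm : m ≠ 0) {t : Fin 2 → ℂ} (ht : t ∈ M) :
    t ∉ (I2 m).bifurcationSet M ↔ t 1 ≠ 0 := by
  obtain ⟨s, hs⟩ := IsAlgClosed.exists_pow_nat_eq (t 1 ^ (m - 2)) two_pos
  have hs0 (h : s = 0) : t 1 = 0 :=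
    eq_zero_of_pow_eq_zero (hs.symm.trans (by rw [h, zero_pow two_ne_zero]))
  simp only [TangentData.bifurcationSet, Set.mem_ofPred_eq, ht, true_and, not_not,
    roots_charpoly_eulerMatrix_I2 hs, Multiset.insert_eq_cons, Multiset.nodup_cons,
    Multiset.mem_singleton, Multiset.nodup_singleton, and_true,
    sheetValue_eq_sheetValue_neg_iff hm, or_iff_left_of_imp hs0, ne_eq]

theorem exists_mem_one_ne_zero (hM : (M : Set (Fin 2 → ℂ)).Nonempty) : ∃ t ∈ M, t 1 ≠ 0 :=
  ((dense_compl_singleton (0 : ℂ)).preimage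
    (isOpenMap_eval (1 : Fin 2))).inter_open_nonempty _ M.isOpen hM

end Spectrum

section EvenSpectrum

variable {M : TopologicalSpace.Opens (Fin 2 → ℂ)} {k : ℕ} {c : ℂ}

/-- The graph `y = (1, c t₂^k)` in the cotangent bundle of `M`. For even `m = 2k + 2`, the analytic
spectrum of `I₂(m)` is the union of the branches with `c = ±1`. -/
def branch (M : TopologicalSpace.Opens (Fin 2 → ℂ)) (k : ℕ) (c : ℂ) :
    Set ((Fin 2 → ℂ) × (Fin 2 → ℂ)) :=
  (fun t => (t, ![1, c * t 1 ^ k])) '' (M : Set (Fin 2 → ℂ))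

theorem mem_branch {p : (Fin 2 → ℂ) × (Fin 2 → ℂ)} :
    p ∈ branch M k c ↔ p.1 ∈ M ∧ p.2 0 = 1 ∧ p.2 1 = c * p.1 1 ^ k := by
  constructor
  · rintro ⟨t, ht, rfl⟩
    exact ⟨ht, rfl, rfl⟩
  · rintro ⟨hM, hy, hy'⟩
    exact ⟨p.1, hM, Prod.ext rfl (List.ofFn_inj.1 (by simp [hy, hy']))⟩

theorem isAnalyticSubset_branch :
    IsAnalyticSubset ((M : Set (Fin 2 → ℂ)) ×ˢ Set.univ) (branch M k c) := by
  convert isAnalyticSubset_zeros (M.isOpen.prod isOpen_univ)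
    ![fun p : (Fin 2 → ℂ) × (Fin 2 → ℂ) => p.2 0 - 1, fun p => p.2 1 - c * p.1 1 ^ k] ?_ using 1
  · ext p
    simp [mem_branch, Fin.forall_fin_two, sub_eq_zero]
  · intro i p _
    fin_cases i <;> exact ContDiffAt.analyticAt (by dsimp; fun_prop)

theorem isIrreducible_branch (hM : IsConnected (M : Set (Fin 2 → ℂ))) :
    IsIrreducibleAnalyticSubset ((M : Set (Fin 2 → ℂ)) ×ˢ Set.univ) (branch M k c) :=
  IsAnalyticSubset.isIrreducible_image M.isOpen hM (fun _ _ => ContDiffAt.analyticAt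
    (contDiffAt_id.prodMk (contDiffAt_pi.2 (Fin.forall_fin_two.2
      ⟨contDiffAt_const, by dsimp; fun_prop⟩)))) isAnalyticSubset_branch

theorem not_branch_subset_branch (hM : (M : Set (Fin 2 → ℂ)).Nonempty) {d : ℂ} (hcd : c ≠ d) :
    ¬ branch M k c ⊆ branch M k d := by
  intro h
  obtain ⟨t, ht, ht1⟩ := exists_mem_one_ne_zero hM
  exact hcd (mul_right_cancel₀ (pow_ne_zero k ht1) (mem_branch.1 (h ⟨t, ht, rfl⟩)).2.2)

variable (M k) in
theorem spectrum_I2_even : (I2 (2 * k + 2)).spectrum M = branch M k 1 ∪ branch M k (-1) := by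
  ext p
  rw [Set.mem_union, mem_branch, mem_branch, mem_spectrum_I2, Nat.add_sub_cancel, mul_comm 2 k,
    pow_mul, sq_eq_sq_iff_eq_or_eq_neg, one_mul, neg_one_mul]
  tauto

theorem spectrumComponents_I2_even (hM : IsConnected (M : Set (Fin 2 → ℂ))) :
    (I2 (2 * k + 2)).spectrumComponents M = {branch M k 1, branch M k (-1)} := by
  have hne : (1 : ℂ) ≠ -1 := by norm_num
  rw [TangentData.spectrumComponents, spectrum_I2_even,
    components_union (isIrreducible_branch hM) (isIrreducible_branch hM)
      (not_branch_subset_branch hM.nonempty hne) (not_branch_subset_branch hM.nonempty hne.symm)]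

end EvenSpectrum

section OddSpectrum

variable {M : TopologicalSpace.Opens (Fin 2 → ℂ)}

/-- The double covering `(t₁, s) ↦ (t₁, s²)` of the plane, on which the square root of `t₂` which
parametrizes the analytic spectrum of `I₂(m)` for odd `m` is single valued. -/
def squareSnd (x : Fin 2 → ℂ) : Fin 2 → ℂ := ![x 0, x 1 ^ 2]

theorem contDiff_squareSnd : ContDiff ℂ ω squareSnd :=
  contDiff_pi.2 (Fin.forall_fin_two.2
    ⟨contDiff_apply ℂ ℂ 0, (contDiff_apply ℂ ℂ 1).pow 2⟩)

theorem isOpenMap_squareSnd : IsOpenMap squareSnd := by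
  have hsq : IsOpenMap fun s : ℂ => s ^ 2 := by
    refine (AnalyticOnNhd.is_constant_or_isOpenMap (g := fun s : ℂ => s ^ 2)
      fun s _ => by fun_prop).resolve_left ?_
    rintro ⟨w, hw⟩
    simpa using (hw 0).trans (hw 1).symm
  have heq : squareSnd = Pi.map ![id, fun s => s ^ 2] := by
    ext x i
    fin_cases i <;> rfl
  rw [heq]
  exact IsOpenMap.piMap (Fin.forall_fin_two.2 ⟨IsOpenMap.id, hsq⟩) (by simp)

theorem squareSnd_eq_squareSnd_iff {x x' : Fin 2 → ℂ} :
    squareSnd x = squareSnd x' ↔ x' = x ∨ x' = ![x 0, -x 1] := by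
  simp only [squareSnd, funext_iff, Fin.forall_fin_two, Matrix.cons_val_zero,
    Matrix.cons_val_one, sq_eq_sq_iff_eq_or_eq_neg]
  grind

theorem surjective_squareSnd : Function.Surjective squareSnd := fun y => by
  obtain ⟨s, hs⟩ := IsAlgClosed.exists_pow_nat_eq (y 1) two_pos
  exact ⟨![y 0, s], funext (Fin.forall_fin_two.2 ⟨rfl, hs⟩)⟩

theorem isConnected_preimage_squareSnd (hM : IsConnected (M : Set (Fin 2 → ℂ)))
    (h0 : ∃ t ∈ M, t 1 = 0) : IsConnected (squareSnd ⁻¹' (M : Set (Fin 2 → ℂ))) := by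
  obtain ⟨t, htM, ht⟩ := h0
  have hqt : squareSnd t = t := funext (Fin.forall_fin_two.2 ⟨rfl, by simp [squareSnd, ht]⟩)
  refine ⟨hM.nonempty.preimage surjective_squareSnd,
    isPreconnected_preimage_of_branchPoint (σ := fun x => ![x 0, -x 1]) (x₀ := t)
      isOpenMap_squareSnd ?_ (fun _ _ => squareSnd_eq_squareSnd_iff) ?_ hM.isPreconnected
      (by simp [surjective_squareSnd.range_eq]) (by rwa [hqt])⟩
  · exact continuous_pi (Fin.forall_fin_two.2 ⟨continuous_apply 0, (continuous_apply 1).neg⟩)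
  · exact funext (Fin.forall_fin_two.2 ⟨rfl, by simp [ht]⟩)

theorem exists_sq_eq_and_pow_eq {R : Type*} [CommRing R] [IsDomain R] {a b s : R} {k : ℕ}
    (hs : s ^ 2 = a) (h : b ^ 2 = a ^ (2 * k + 1)) : ∃ s, s ^ 2 = a ∧ s ^ (2 * k + 1) = b := by
  rw [← hs, ← pow_mul, mul_comm, pow_mul, sq_eq_sq_iff_eq_or_eq_neg] at h
  rcases h with h | h
  · exact ⟨s, hs, h.symm⟩
  · exact ⟨-s, by rw [neg_sq, hs], by rw [Odd.neg_pow ⟨k, rfl⟩, h]⟩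

variable (M) in
theorem spectrum_I2_odd (k : ℕ) : (I2 (2 * k + 3)).spectrum M =
    (fun x => (squareSnd x, ![1, x 1 ^ (2 * k + 1)])) '' (squareSnd ⁻¹' (M : Set (Fin 2 → ℂ))) := by
  ext ⟨t, y⟩
  rw [mem_spectrum_I2, show 2 * k + 3 - 2 = 2 * k + 1 by omega]
  constructor
  · rintro ⟨ht, hy, hsq⟩
    obtain ⟨s₀, hs₀⟩ := IsAlgClosed.exists_pow_nat_eq (t 1) two_pos
    obtain ⟨s, hs, hsy⟩ := exists_sq_eq_and_pow_eq hs₀ hsq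
    have hq : squareSnd ![t 0, s] = t := funext (Fin.forall_fin_two.2 ⟨rfl, hs⟩)
    exact ⟨![t 0, s], by rwa [Set.mem_preimage, hq],
      Prod.ext hq (funext (Fin.forall_fin_two.2 ⟨hy.symm, hsy⟩))⟩
  · rintro ⟨x, hx, hxp⟩
    obtain ⟨rfl, rfl⟩ := Prod.ext_iff.1 hxp
    exact ⟨hx, rfl, pow_right_comm (x 1) (2 * k + 1) 2⟩

theorem spectrumComponents_I2_odd (hM : IsConnected (M : Set (Fin 2 → ℂ)))
    (h0 : ∃ t ∈ M, t 1 = 0) (k : ℕ) :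
    (I2 (2 * k + 3)).spectrumComponents M = {(I2 (2 * k + 3)).spectrum M} := by
  refine components_eq_singleton ?_
  have hanalytic := isAnalyticSubset_spectrum_I2 (M := M) (m := 2 * k + 3)
  rw [spectrum_I2_odd] at hanalytic ⊢
  exact hanalytic.isIrreducible_image (M.isOpen.preimage contDiff_squareSnd.continuous)
    (isConnected_preimage_squareSnd hM h0) fun _ _ => ContDiffAt.analyticAt
      (contDiff_squareSnd.contDiffAt.prodMk (contDiffAt_pi.2 (Fin.forall_fin_two.2
        ⟨contDiffAt_const, by dsimp; fun_prop⟩)))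

end OddSpectrum

/-! ### The normal form -/

section NormalExponent

variable {m k : ℕ} {α lam c s : ℂ} {t : Fin 2 → ℂ}

/-- The regular singular exponent at the point `y = (1, s)` of the analytic spectrum over `t` of a
connection in normal form. -/
def normalExponent (m : ℕ) (α lam : ℂ) (t : Fin 2 → ℂ) (s : ℂ) : ℂ :=
  α - t 1 * normalF m lam t / (m * s)

theorem normalExponent_even (hk : k ≠ 0) (ht : t 1 ≠ 0) :
    normalExponent (2 * k + 2) α lam t (c * t 1 ^ k) = α - lam / ((2 * k + 2 : ℕ) * c) := by
  have hf : t 1 * normalF (2 * k + 2) lam t = lam * t 1 ^ k := by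
    rw [normalF, if_pos ⟨k + 1, by ring⟩, show (2 * k + 2 - 4) / 2 = k - 1 by omega, mul_left_comm,
      mul_pow_sub_one hk]
  rw [normalExponent, hf, ← mul_assoc, mul_div_mul_right _ _ (pow_ne_zero k ht)]

theorem normalExponent_odd (hm : Odd m) : normalExponent m α lam t s = α := by
  simp [normalExponent, normalF, Nat.not_even_iff_odd.2 hm]

theorem analyticAt_normalB (t : Fin 2 → ℂ) (i j : Fin 2) :
    AnalyticAt ℂ (fun z => normalB m α lam z t i j) 0 := by
  simp only [normalB, Matrix.add_apply, Matrix.smul_apply, smul_eq_mul]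
  fun_prop

theorem injective_sheetValue (hm : m ≠ 0) (ht : t 1 ≠ 0) (hs : s ≠ 0) :
    Function.Injective ![sheetValue m t s, sheetValue m t (-s)] := by
  have hne : sheetValue m t s ≠ sheetValue m t (-s) := by
    simp [sheetValue_eq_sheetValue_neg_iff hm, ht, hs]
  simpa [Function.Injective, Fin.forall_fin_two, hne] using hne.symm

/-- The matrix of eigenvectors `(±s, 1)` of `C₂`, for `s² = t₂^(m-2)`. -/
def eigenMatrix (s : ℂ) : Matrix (Fin 2) (Fin 2) ℂ := !![s, -s; 1, 1]

theorem isUnit_eigenMatrix (hs : s ≠ 0) : IsUnit (eigenMatrix s) := by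
  rw [Matrix.isUnit_iff_isUnit_det, eigenMatrix, Matrix.det_fin_two_of, isUnit_iff_ne_zero]
  ring_nf
  exact mul_ne_zero hs two_ne_zero

/-- The coefficient of `z` of the connection matrix in the basis of eigenvectors of `C₂`. -/
def eigenResidue (m : ℕ) (α lam : ℂ) (t : Fin 2 → ℂ) (s : ℂ) : Matrix (Fin 2) (Fin 2) ℂ :=
  !![normalExponent m α lam t s,
      -((2 - m) / (2 * m)) - t 1 * normalF m lam t / (m * s);
    -((2 - m) / (2 * m)) + t 1 * normalF m lam t / (m * s),
      normalExponent m α lam t (-s)]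

theorem normalB_mul_eigenMatrix (hs0 : s ≠ 0) (hs : s ^ 2 = t 1 ^ (m - 2))
    (z : ℂ) : normalB m α lam z t * eigenMatrix s = eigenMatrix s *
      (Matrix.diagonal (fun i => -![sheetValue m t s, sheetValue m t (-s)] i) +
        z • eigenResidue m α lam t s) := by
  have hlead : ((-t 0) • (1 : Matrix (Fin 2) (Fin 2) ℂ) - (2 / (m : ℂ) * t 1) • matC2 m t) *
      eigenMatrix s = eigenMatrix s *
        Matrix.diagonal (fun i => -![sheetValue m t s, sheetValue m t (-s)] i) := by
    ext i j
    fin_cases i <;> fin_cases j <;>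
      simp [Matrix.mul_apply, Fin.sum_univ_two, matC2, ← hs, Matrix.diagonal, Matrix.one_apply,
        eigenMatrix, sheetValue] <;> ring
  have hresidue : (α • (1 : Matrix (Fin 2) (Fin 2) ℂ) + ((2 - (m : ℂ)) / (2 * (m : ℂ))) • matD +
      (-2 / (m : ℂ) * t 1 * normalF m lam t) • matE) * eigenMatrix s =
        eigenMatrix s * eigenResidue m α lam t s := by
    ext i j
    fin_cases i <;> fin_cases j <;>
      simp [Matrix.mul_apply, Fin.sum_univ_two, matD, matE, normalExponent, Matrix.one_apply,
        eigenMatrix, eigenResidue] <;> field_simp <;> ring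
  rw [normalB, add_mul, hlead, Matrix.smul_mul, hresidue, mul_add, Matrix.mul_smul]

theorem exists_isFormalGauge_taylor_normalB (hm : m ≠ 0) (ht : t 1 ≠ 0)
    (hs : s ^ 2 = t 1 ^ (m - 2)) :
    ∃ T, IsUnit T ∧ IsFormalGauge (TEStructure.taylor fun z => normalB m α lam z t) T
      (diagMatrix ![sheetValue m t s, sheetValue m t (-s)]
        ![normalExponent m α lam t s, normalExponent m α lam t (-s)]) := by
  have hs0 : s ≠ 0 := ne_zero_pow two_ne_zero (hs ▸ pow_ne_zero _ ht)
  have hdiag : (eigenResidue m α lam t s).diag =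
      ![normalExponent m α lam t s, normalExponent m α lam t (-s)] :=
    funext (Fin.forall_fin_two.2 ⟨rfl, rfl⟩)
  rw [← hdiag]
  exact exists_isFormalGauge_taylor_of_mul_eq (analyticAt_normalB t) (isUnit_eigenMatrix hs0)
    (injective_sheetValue hm ht hs0) (normalB_mul_eigenMatrix hs0 hs)

end NormalExponent

section NormalForm

variable {M : TopologicalSpace.Opens (Fin 2 → ℂ)}
  {H : Base M → Type*} [TopologicalSpace (Bundle.TotalSpace (Fin 2 → ℂ) H)]
  [∀ x, AddCommGroup (H x)] [∀ x, Module ℂ (H x)] [∀ x, TopologicalSpace (H x)]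
  [FiberBundle (Fin 2 → ℂ) H]

namespace TEStructure

/-- On `V × M`, for some open neighbourhood `V` of `0`, the connection has the normal form with
parameters `α` and `lam` in some holomorphic basis. -/
def HasNormalForm (S : TEStructure 2 H) (m : ℕ) (α lam : ℂ) : Prop :=
  ∃ (V : Set ℂ) (v : Fin 2 → ∀ x, H x), IsOpen V ∧ 0 ∈ V ∧ HolBasis 2 v {x | x.1.1 ∈ V} ∧
    S.HasMatrices v {x | x.1.1 ∈ V} (normalA m lam) (normalB m α lam)

namespace HasNormalForm

variable {S : TEStructure 2 H} {m k : ℕ} {α lam : ℂ} {t : M}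

theorem isSliceMatrix (h : S.HasNormalForm m α lam) (t : M) :
    S.IsSliceMatrix t fun z => normalB m α lam z t := by
  obtain ⟨V, v, hV, h0V, hv, hvn⟩ := h
  refine ⟨{x | x.1.1 ∈ V}, v, hV.preimage (continuous_fst.comp continuous_subtype_val), h0V, hv,
    analyticAt_normalB t, fun z hz j => (hvn _ hz j).2⟩

theorem formallyDecomposes (h : S.HasNormalForm m α lam) (hm : m ≠ 0) (ht : t.1 1 ≠ 0) {s : ℂ}
    (hs : s ^ 2 = t.1 1 ^ (m - 2)) : S.FormallyDecomposes t
      ![sheetValue m t s, sheetValue m t (-s)]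
      ![normalExponent m α lam t s, normalExponent m α lam t (-s)] := by
  obtain ⟨T, hT, hg⟩ := exists_isFormalGauge_taylor_normalB hm ht hs
  exact formallyDecomposes_iff.2 ⟨_, T, h.isSliceMatrix t, hT, hg⟩

variable [VectorBundle ℂ (Fin 2 → ℂ) H]
  [ContMDiffVectorBundle ω (Fin 2 → ℂ) H 𝓘(ℂ, ℂ × (Fin 2 → ℂ))]

theorem hasExponents (h : S.HasNormalForm m α lam) (hm : m ≠ 0) (ht : t.1 1 ≠ 0) {s : ℂ}
    (hs : s ^ 2 = t.1 1 ^ (m - 2)) :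
    S.HasExponents t {normalExponent m α lam t s, normalExponent m α lam t (-s)} :=
  (h.formallyDecomposes hm ht hs).hasExponents

theorem isExponentAt_iff (h : S.HasNormalForm m α lam) (hm : m ≠ 0) (ht : t.1 1 ≠ 0)
    {y : Fin 2 → ℂ} (hy : (t.1, y) ∈ (I2 m).spectrum M) (γ : ℂ) :
    S.IsExponentAt (I2 m) t y γ ↔ γ = normalExponent m α lam t (y 1) := by
  obtain ⟨-, hy0, hsq⟩ := mem_spectrum_I2.1 hy
  have hy1 : y 1 ≠ 0 := ne_zero_pow two_ne_zero (hsq ▸ pow_ne_zero _ ht)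
  exact (h.formallyDecomposes hm ht hsq).isExponentAt_iff (injective_sheetValue hm ht hy1)
    (i := 0) (sum_euler_I2_mul hy0).symm γ

theorem exponentOn (h : S.HasNormalForm m α lam) (hm : m ≠ 0)
    {Z : Set ((Fin 2 → ℂ) × (Fin 2 → ℂ))} {β : ℂ} (hZ : Z ⊆ (I2 m).spectrum M)
    (hne : ∃ p ∈ Z, p.1 1 ≠ 0)
    (hβ : ∀ p ∈ Z, p.1 1 ≠ 0 → normalExponent m α lam p.1 (p.2 1) = β) :
    S.ExponentOn (I2 m) Z β := by
  obtain ⟨p, hp, hp1⟩ := hne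
  have hpM : p.1 ∈ M := (mem_spectrum_I2.1 (hZ hp)).1
  refine ⟨⟨p, hp, hpM, (notMem_bifurcationSet_I2 hm hpM).2 hp1⟩, fun t y hy ht γ => ?_⟩
  have ht1 : t.1 1 ≠ 0 := (notMem_bifurcationSet_I2 hm t.2).1 ht
  rw [h.isExponentAt_iff hm ht1 (hZ hy), hβ _ hy ht1]

theorem exponentOn_branch (h : S.HasNormalForm (2 * k + 2) α lam) (hk : k ≠ 0)
    (hM : (M : Set (Fin 2 → ℂ)).Nonempty) {c : ℂ}
    (hc : branch M k c ⊆ (I2 (2 * k + 2)).spectrum M) :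
    S.ExponentOn (I2 (2 * k + 2)) (branch M k c) (α - lam / ((2 * k + 2 : ℕ) * c)) := by
  refine h.exponentOn (by omega) hc ?_ fun p hp hp1 => ?_
  · obtain ⟨t, ht, ht1⟩ := exists_mem_one_ne_zero hM
    exact ⟨_, ⟨t, ht, rfl⟩, ht1⟩
  · rw [(mem_branch.1 hp).2.2, normalExponent_even hk hp1]

theorem exponentOn_branch_one (h : S.HasNormalForm (2 * k + 2) α lam) (hk : k ≠ 0)
    (hM : (M : Set (Fin 2 → ℂ)).Nonempty) :
    S.ExponentOn (I2 (2 * k + 2)) (branch M k 1) (α - lam / (2 * k + 2 : ℕ)) := by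
  have hexp := h.exponentOn_branch hk hM (spectrum_I2_even M k ▸ Set.subset_union_left)
  rwa [mul_one] at hexp

theorem exponentOn_branch_neg_one (h : S.HasNormalForm (2 * k + 2) α lam) (hk : k ≠ 0)
    (hM : (M : Set (Fin 2 → ℂ)).Nonempty) :
    S.ExponentOn (I2 (2 * k + 2)) (branch M k (-1)) (α + lam / (2 * k + 2 : ℕ)) := by
  have hexp := h.exponentOn_branch hk hM (spectrum_I2_even M k ▸ Set.subset_union_right)
  rwa [mul_neg_one, div_neg, sub_neg_eq_add] at hexp

theorem hasExponents_even (h : S.HasNormalForm (2 * k + 2) α lam) (hk : k ≠ 0)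
    (ht : t.1 1 ≠ 0) :
    S.HasExponents t {α - lam / (2 * k + 2 : ℕ), α + lam / (2 * k + 2 : ℕ)} := by
  have hs : (1 * t.1 1 ^ k) ^ 2 = t.1 1 ^ (2 * k + 2 - 2) := by
    rw [one_mul, ← pow_mul, Nat.add_sub_cancel, mul_comm]
  have hexp := h.hasExponents (by omega) ht hs
  rwa [← neg_mul, normalExponent_even hk ht, normalExponent_even hk ht, mul_one, mul_neg_one,
    div_neg, sub_neg_eq_add] at hexp

theorem exponentOn_odd (h : S.HasNormalForm m α lam) (hm : Odd m)
    (hM : (M : Set (Fin 2 → ℂ)).Nonempty) :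
    S.ExponentOn (I2 m) ((I2 m).spectrum M) α := by
  refine h.exponentOn hm.pos.ne' subset_rfl ?_ fun _ _ _ => normalExponent_odd hm
  obtain ⟨t, ht, ht1⟩ := exists_mem_one_ne_zero hM
  obtain ⟨s, hs⟩ := IsAlgClosed.exists_pow_nat_eq (t 1 ^ (m - 2)) two_pos
  exact ⟨(t, ![1, s]), mem_spectrum_I2.2 ⟨ht, rfl, hs⟩, ht1⟩

theorem hasExponents_odd (h : S.HasNormalForm m α lam) (hm : Odd m) (ht : t.1 1 ≠ 0) :
    S.HasExponents t {α, α} := by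
  obtain ⟨s, hs⟩ := IsAlgClosed.exists_pow_nat_eq (t.1 1 ^ (m - 2)) two_pos
  simpa only [normalExponent_odd hm] using h.hasExponents hm.pos.ne' ht hs

end HasNormalForm

end TEStructure

end NormalForm

end TE

end

theorem theorem8p6 (m : ℕ) (hm : 3 ≤ m)
    -- `M` is a representative of the germ `(ℂ², 0)`, and `H → ℂ × M` a holomorphic vector bundle
    (M : TopologicalSpace.Opens (Fin 2 → ℂ)) (hM : IsConnected (M : Set (Fin 2 → ℂ)))
    (h0 : (0 : Fin 2 → ℂ) ∈ M)
    {H : TE.Base M → Type*} [TopologicalSpace (Bundle.TotalSpace (Fin 2 → ℂ) H)]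
    [∀ x, AddCommGroup (H x)] [∀ x, Module ℂ (H x)] [∀ x, TopologicalSpace (H x)]
    [FiberBundle (Fin 2 → ℂ) H] [VectorBundle ℂ (Fin 2 → ℂ) H]
    [ContMDiffVectorBundle ω (Fin 2 → ℂ) H 𝓘(ℂ, ℂ × (Fin 2 → ℂ))]
    (S : TE.TEStructure 2 H) (hS : S.IsOver (TE.I2 m))
    -- `v` is a basis of `H` on `V × M` in which the connection has the normal form
    (V : Set ℂ) (hV : IsOpen V) (h0V : (0 : ℂ) ∈ V) (v : Fin 2 → ∀ x, H x) (α lam : ℂ)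
    (hv : TE.HolBasis 2 v {x | x.1.1 ∈ V})
    (hvn : S.HasMatrices v {x | x.1.1 ∈ V} (TE.normalA m lam) (TE.normalB m α lam)) :
    (Even m →
      (∃ L₁ L₂, L₁ ≠ L₂ ∧ (TE.I2 m).spectrumComponents M = {L₁, L₂} ∧
        S.ExponentOn (TE.I2 m) L₁ (α - lam / m) ∧ S.ExponentOn (TE.I2 m) L₂ (α + lam / m)) ∧
      ∀ t : M, (t : Fin 2 → ℂ) ∉ (TE.I2 m).bifurcationSet M →
        S.HasExponents t {α - lam / m, α + lam / m}) ∧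
    (Odd m →
      (∃ L, (TE.I2 m).spectrumComponents M = {L} ∧ S.ExponentOn (TE.I2 m) L α) ∧
      ∀ t : M, (t : Fin 2 → ℂ) ∉ (TE.I2 m).bifurcationSet M → S.HasExponents t {α, α}) := by
  have h : S.HasNormalForm m α lam := ⟨V, v, hV, h0V, hv, hvn⟩
  have hm0 : m ≠ 0 := by omega
  constructor
  · intro heven
    obtain ⟨k, hk, rfl⟩ : ∃ k, k ≠ 0 ∧ m = 2 * k + 2 := by
      obtain ⟨j, rfl⟩ := heven
      exact ⟨j - 1, by omega, by omega⟩
    refine ⟨⟨TE.branch M k 1, TE.branch M k (-1), ?_, TE.spectrumComponents_I2_even hM,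
      h.exponentOn_branch_one hk hM.nonempty, h.exponentOn_branch_neg_one hk hM.nonempty⟩,
      fun t ht => h.hasExponents_even hk ((TE.notMem_bifurcationSet_I2 hm0 t.2).1 ht)⟩
    exact fun heq => TE.not_branch_subset_branch hM.nonempty (by norm_num) heq.subset
  · intro hodd
    obtain ⟨k, rfl⟩ : ∃ k, m = 2 * k + 3 := by
      obtain ⟨j, rfl⟩ := hodd
      exact ⟨j - 1, by omega⟩
    exact ⟨⟨_, TE.spectrumComponents_I2_odd hM ⟨0, h0, rfl⟩ k,
      h.exponentOn_odd hodd hM.nonempty⟩,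
      fun t ht => h.hasExponents_odd hodd ((TE.notMem_bifurcationSet_I2 hm0 t.2).1 ht)⟩
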